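/- Let $n\ge 1$, $\mathbb T^n=\mathbb R^n/\mathbb Z^n$ with normalised Haar measure, and let $|k|$ be the Euclidean norm of $k\in\mathbb Z^n$. For $\nu\in\mathbb R$ let $S^\nu(\mathbb T^n\times\mathbb Z^n)$ be the class of functions $\sigma:\mathbb T^n\times\mathbb Z^n\to\mathbb C$ that are smooth in the first variable and satisfy, for all multi-indices $\alpha,\beta\in\mathbb N_0^n$, $$|\Delta_k^\alpha\partial_x^\beta\sigma(x,k)|\le C_{\alpha\beta}(1+|k|)^{\nu-|\alpha|}\qquad(x\in\mathbb T^n,\ k\in\mathbb Z^n),$$ where $\Delta_{k_i}a(k)=a(k+e_i)-a(k)$. Write $\widehat\sigma(l,k)=\int_{\mathbb T^n}e^{-2\pi i x\cdot l}\sigma(x,k)\,dx$. The toroidal quantisation of $\sigma$ is the operator $T=\sigma(x,D)$ defined on $C^\infty(\mathbb T^n)\subset L^2(\mathbb T^n)$ by $Tf(x)=\sum_{k\in\mathbb Z^n}e^{2\pi i x\cdot k}\sigma(x,k)\widehat f(k)$; if it has a bounded extension to $L^2(\mathbb T^n)$, that extension is again denoted by $T$. Let $\mathcal D_2$ be the algebra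 of bounded operators $A$ on $\ell^2(\mathbb Z^n)$ whose matrix $(a_{jk})$ in the standard basis satisfies $\|A\|_{\mathcal D_2}=\sum_{j,k\in\mathbb Z^n}|a_{jk}|<\infty$, and let $\Gamma(\mathcal D_2)=\{\Gamma(A)=\mathcal F^{-1}A\mathcal F: A\in\mathcal D_2\}$, where $\mathcal F:L^2(\mathbb T^n)\to\ell^2(\mathbb Z^n)$ is the Fourier transform. For a finite rank operator $F$, $\mathrm{Det}(I+F)$ is the determinant of $I+F$ restricted to a finite-dimensional $F$-invariant subspace that has a complement contained in $\ker F$. For $A\in\mathcal D_2$, the Poincaré determinant $\mathrm{Det}(I+A)$ is the limit of $\mathrm{Det}(I+F)$ as $\|F-A\|_{\mathcal D_2}\to0$ with $F\in\mathcal D_2$ of finite rank, and $\mathrm{Det}(I+\Gamma(A)):=\mathrm{Det}(I+A)$. Theorem. (a) Let $\sigma\in S^\nu(\mathbb T^n\times\mathbb Z^n)$ with $\nu<-n$. Then $T=\sigma(x,D)$ has a unique bounded extension to $L^2(\mathbb T^n)$, this extension lies in $\Gamma(\mathcal D_2)$, and there is $\varepsilon>0$ such that for all $\lambda\in\mathbb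 C$ with $|\lambda|<\varepsilon$ the determinant $\mathrm{Det}(I+\lambda T)$ exists and $$\mathrm{Det}(I+\lambda T)=\exp\left(\sum_{m=1}^\infty\frac{(-1)^{m+1}}{m}\lambda^m\sum_{\substack{(j_0,\dots,j_m)\in(\mathbb Z^n)^{m+1}\\ j_0=j_m}}\ \prod_{s=1}^m\widehat\sigma(j_{s-1}-j_s,j_s)\right),$$ all these series being absolutely convergent. (b) The condition $\nu<-n$ is sharp: the symbol $\sigma_0(x,k)=(1+|k|)^{-n}$ belongs to $S^{\nu}(\mathbb T^n\times\mathbb Z^n)$ for every $\nu\ge -n$, and its quantisation has a unique bounded extension to $L^2(\mathbb T^n)$, which does not belong to $\Gamma(\mathcal D_2)$. -/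

import Mathlib

open Filter Topology MeasureTheory UnitAddTorus
open scoped ContDiff

/-- The circle `ℝ / ℤ` carries its Haar measure of total mass one. -/
noncomputable local instance : MeasureSpace UnitAddCircle := ⟨AddCircle.haarAddCircle⟩

local instance : Measure.IsAddHaarMeasure (volume : Measure UnitAddCircle) :=
  inferInstanceAs (Measure.IsAddHaarMeasure AddCircle.haarAddCircle)

local instance : IsProbabilityMeasure (volume : Measure UnitAddCircle) :=
  inferInstanceAs (IsProbabilityMeasure AddCircle.haarAddCircle)

noncomputable section

/-- The torus `𝕋ⁿ = ℝⁿ / ℤⁿ`. -/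
abbrev Torus (n : ℕ) : Type := UnitAddTorus (Fin n)

/-- The lattice `ℤⁿ`. -/
abbrev IntLattice (n : ℕ) : Type := Fin n → ℤ

/-- The Hilbert space `L²(𝕋ⁿ)`. -/
abbrev TorusL2 (n : ℕ) : Type := Lp ℂ 2 (volume : Measure (Torus n))

/-- The Hilbert space `ℓ²(ℤⁿ)`. -/
abbrev LatticeL2 (n : ℕ) : Type := lp (fun _ : IntLattice n => ℂ) 2

/-- The Euclidean norm `|k|` of a lattice point. -/
def latticeNorm {n : ℕ} (k : IntLattice n) : ℝ := √(∑ i, (k i : ℝ) ^ 2)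

section Symbols

/-- The `ℤⁿ`-periodic function on `ℝⁿ` that corresponds to a function on `𝕋ⁿ`. -/
def torusLift {n : ℕ} (f : Torus n → ℂ) : (Fin n → ℝ) → ℂ :=
  fun x => f (fun i => (x i : UnitAddCircle))

/-- `f ∈ C^∞(𝕋ⁿ)`. -/
def IsTorusSmooth {n : ℕ} (f : Torus n → ℂ) : Prop := ContDiff ℝ ∞ (torusLift f)

/-- The partial derivative `∂_{x_i}` of a function on `ℝⁿ`. -/
def partialDeriv {n : ℕ} (i : Fin n) (g : (Fin n → ℝ) → ℂ) : (Fin n → ℝ) → ℂ :=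
  fun x => lineDeriv ℝ g x (Pi.single i 1)

/-- The partial derivative `∂_x^β = ∂_{x_1}^{β_1} ⋯ ∂_{x_n}^{β_n}`. -/
def multiDeriv {n : ℕ} (β : Fin n → ℕ) (g : (Fin n → ℝ) → ℂ) : (Fin n → ℝ) → ℂ :=
  (List.finRange n).foldr (fun i h => (partialDeriv i)^[β i] h) g

/-- The difference operator `Δ_k^α = Δ_{k_1}^{α_1} ⋯ Δ_{k_n}^{α_n}`, where
`(Δ_{k_i} a)(k) = a (k + e_i) - a k`. -/
def multiDiff {n : ℕ} (α : Fin n → ℕ) (a : IntLattice n → ℂ) : IntLattice n → ℂ :=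
  (List.finRange n).foldr (fun i b => (fwdDiff (Pi.single i 1 : IntLattice n))^[α i] b) a

/-- The toroidal symbol class `S^ν(𝕋ⁿ × ℤⁿ)`: `σ(·, k)` is smooth for every `k`, and
`|Δ_k^α ∂_x^β σ(x, k)| ≤ C_{αβ} (1 + |k|)^(ν - |α|)`. -/
structure IsToroidalSymbol {n : ℕ} (ν : ℝ) (σ : Torus n → IntLattice n → ℂ) : Prop where
  smooth : ∀ k, IsTorusSmooth (fun x => σ x k)
  bound : ∀ α β : Fin n → ℕ, ∃ C : ℝ, ∀ (x : Fin n → ℝ) (k : IntLattice n),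
    ‖multiDiff α (fun l => multiDeriv β (torusLift (fun y => σ y l)) x) k‖
      ≤ C * (1 + latticeNorm k) ^ (ν - ∑ i, (α i : ℝ))

/-- The Fourier coefficient `σ̂(l, k) = ∫ e^{-2πi x·l} σ(x, k) dx` of a symbol in its first
variable. -/
def symbolCoeff {n : ℕ} (σ : Torus n → IntLattice n → ℂ) (l k : IntLattice n) : ℂ :=
  mFourierCoeff (fun x => σ x k) l

/-- The bounded operator `T` on `L²(𝕋ⁿ)` extends the toroidal quantisation of `σ`, which is
defined on the dense subspace `C^∞(𝕋ⁿ)` by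
`T f (x) = ∑_k e^{2πi x·k} σ(x, k) f̂(k)`. -/
def ExtendsQuantisation {n : ℕ} (σ : Torus n → IntLattice n → ℂ)
    (T : TorusL2 n →L[ℂ] TorusL2 n) : Prop :=
  ∀ f : C(Torus n, ℂ), IsTorusSmooth f →
    ∀ᵐ x, HasSum (fun k : IntLattice n => mFourier k x * σ x k * mFourierCoeff f k)
      (T (ContinuousMap.toLp 2 volume ℂ f) x)

end Symbols

section Determinant

/-- For a linear map `F` of finite rank, `Det(I + F) = det(I + F|_M)` with the choice
`M = range F`; see `finiteRankDet_eq` for the other choices of `M`. -/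
def finiteRankDet {E : Type*} [AddCommGroup E] [Module ℂ E] (F : E →ₗ[ℂ] E) : ℂ :=
  LinearMap.det (1 + F.restrict (p := F.range) (q := F.range) (fun x _ => ⟨x, rfl⟩))

/-- The finite dimensional subspaces `M` used to define `Det(I + F)` are those for which there is
a complement `N ⊆ ker F` and `F M ⊆ M`; all of them give the same value `det(I + F|_M)`. -/
theorem finiteRankDet_eq {E : Type*} [AddCommGroup E] [Module ℂ E] (F : E →ₗ[ℂ] E)
    (M N : Submodule ℂ E) [FiniteDimensional ℂ M] (hMN : IsCompl M N)
    (hM : ∀ x ∈ M, F x ∈ M) (hN : N ≤ F.ker) :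
    LinearMap.det (1 + F.restrict hM) = finiteRankDet F := by
  have hR : F.range ≤ M := by
    rintro _ ⟨x, rfl⟩
    obtain ⟨y, hy, z, hz, rfl⟩ := Submodule.mem_sup.1
      (hMN.sup_eq_top ▸ Submodule.mem_top : x ∈ M ⊔ N)
    rw [map_add, LinearMap.mem_ker.1 (hN hz), add_zero]
    exact hM y hy
  set W : Submodule ℂ M := F.range.comap M.subtype with hW
  have hinv : W ≤ W.comap (1 + F.restrict hM) := fun x hx =>
    W.add_mem hx (show F x ∈ F.range from ⟨x, rfl⟩)
  rw [LinearMap.det_eq_det_mul_det W _ hinv]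
  have hQ : W.mapQ W (1 + F.restrict hM) hinv = LinearMap.id := by
    refine Submodule.linearMap_qext _ (LinearMap.ext fun x => ?_)
    refine (Submodule.Quotient.eq W).2 ?_
    have : (1 + F.restrict hM) x - x = F.restrict hM x := by simp
    rw [this]
    exact ⟨x, rfl⟩
  rw [hQ, LinearMap.det_id, mul_one, finiteRankDet]
  rw [← LinearMap.det_conj _ (Submodule.comapSubtypeEquivOfLe hR)]
  congr 1

/-- The matrix entry `a_{jk}` of an operator on `ℓ²(ℤⁿ)` in the standard basis:
`(A φ)(j) = ∑_k a_{jk} φ(k)`. -/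
def matrixEntry {n : ℕ} (A : LatticeL2 n →L[ℂ] LatticeL2 n) (j k : IntLattice n) : ℂ :=
  A (lp.single 2 k 1) j

/-- The Poincaré algebra `𝒟₂`: the bounded operators on `ℓ²(ℤⁿ)` with matrix in
`ℓ¹(ℤⁿ × ℤⁿ)`. -/
def poincareAlgebra (n : ℕ) : Set (LatticeL2 n →L[ℂ] LatticeL2 n) :=
  {A | Summable fun p : IntLattice n × IntLattice n => ‖matrixEntry A p.1 p.2‖}

/-- The norm of `𝒟₂`. -/
def poincareNorm {n : ℕ} (A : LatticeL2 n →L[ℂ] LatticeL2 n) : ℝ :=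
  ∑' p : IntLattice n × IntLattice n, ‖matrixEntry A p.1 p.2‖

/-- The finite rank operators that belong to `𝒟₂`. -/
def poincareFiniteRank (n : ℕ) : Set (LatticeL2 n →L[ℂ] LatticeL2 n) :=
  {F | F ∈ poincareAlgebra n ∧ FiniteDimensional ℂ (F : LatticeL2 n →ₗ[ℂ] LatticeL2 n).range}

/-- Finite rank operators `F` in `𝒟₂` with `‖F - A‖_{𝒟₂} → 0`. -/
def finiteRankApprox {n : ℕ} (A : LatticeL2 n →L[ℂ] LatticeL2 n) :
    Filter (LatticeL2 n →L[ℂ] LatticeL2 n) :=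
  comap (fun F => poincareNorm (F - A)) (𝓝 0) ⊓ 𝓟 (poincareFiniteRank n)

/-- `A ∈ 𝒟₂` and the Poincaré determinant `Det(I + A)` exists and equals `d`: `A` can be
approximated in `𝒟₂` by finite rank operators `F`, and `Det(I + F) → d` as `F → A` in the norm
of `𝒟₂`. -/
structure HasPoincareDet {n : ℕ} (A : LatticeL2 n →L[ℂ] LatticeL2 n) (d : ℂ) : Prop where
  mem : A ∈ poincareAlgebra n
  approximable : (finiteRankApprox A).NeBot
  tendsto : Tendsto (fun F : LatticeL2 n →L[ℂ] LatticeL2 n =>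
    finiteRankDet (F : LatticeL2 n →ₗ[ℂ] LatticeL2 n)) (finiteRankApprox A) (𝓝 d)

theorem HasPoincareDet.unique {n : ℕ} {A : LatticeL2 n →L[ℂ] LatticeL2 n} {d d' : ℂ}
    (h : HasPoincareDet A d) (h' : HasPoincareDet A d') : d = d' :=
  haveI := h.approximable
  tendsto_nhds_unique h.tendsto h'.tendsto

/-- `Γ(A) = ℱ⁻¹ A ℱ`, where `ℱ : L²(𝕋ⁿ) → ℓ²(ℤⁿ)` is the Fourier transform. -/
def fourierConj {n : ℕ} (A : LatticeL2 n →L[ℂ] LatticeL2 n) : TorusL2 n →L[ℂ] TorusL2 n :=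
  (mFourierBasis (d := Fin n)).repr.symm.toContinuousLinearEquiv.toContinuousLinearMap ∘L A ∘L
    (mFourierBasis (d := Fin n)).repr.toContinuousLinearEquiv.toContinuousLinearMap

/-- The algebra `Γ(𝒟₂)` of operators on `L²(𝕋ⁿ)`. -/
def torusPoincareAlgebra (n : ℕ) : Set (TorusL2 n →L[ℂ] TorusL2 n) :=
  fourierConj '' poincareAlgebra n

/-- `T = Γ(A) ∈ Γ(𝒟₂)` and `Det_Γ(I + T) = Det(I + A)` exists and equals `d`. -/
def HasTorusDet {n : ℕ} (T : TorusL2 n →L[ℂ] TorusL2 n) (d : ℂ) : Prop :=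
  ∃ A : LatticeL2 n →L[ℂ] LatticeL2 n, fourierConj A = T ∧ HasPoincareDet A d

end Determinant

/-- The closed chains `(j_0, …, j_m)` of lattice points, `j_0 = j_m`. -/
abbrev ClosedChain (n m : ℕ) : Type := {j : Fin (m + 1) → IntLattice n // j 0 = j (Fin.last m)}

/-- The product `∏_{s=1}^m σ̂(j_{s-1} - j_s, j_s)` along a closed chain. -/
def chainProd {n m : ℕ} (σ : Torus n → IntLattice n → ℂ) (j : ClosedChain n m) : ℂ :=
  ∏ s : Fin m, symbolCoeff σ (j.1 s.castSucc - j.1 s.succ) (j.1 s.succ)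

/-- The term `(-1)^{m+1} / m · λ^m · ∑_{j_0 = j_m} ∏_{s=1}^m σ̂(j_{s-1} - j_s, j_s)`. -/
def plemeljTerm {n : ℕ} (σ : Torus n → IntLattice n → ℂ) (z : ℂ) (m : ℕ) : ℂ :=
  (-1) ^ (m + 1) / (m : ℂ) * z ^ m * ∑' j : ClosedChain n m, chainProd σ j

/-- The symbol `(1 + |k|)^{-n}`. -/
def borderlineSymbol (n : ℕ) : Torus n → IntLattice n → ℂ :=
  fun _ k => (((1 + latticeNorm k) ^ (-(n : ℝ)) : ℝ) : ℂ)

end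

section FiniteDimensional

variable {V : Type*} [AddCommGroup V] [Module ℂ V] [FiniteDimensional ℂ V]

/-- If `f - μ` is nilpotent, then `tr (f ^ m) = dim V * μ ^ m`. -/
theorem trace_pow_of_isNilpotent_sub (f : Module.End ℂ V) (μ : ℂ)
    (hf : IsNilpotent (f - algebraMap ℂ (Module.End ℂ V) μ)) (m : ℕ) :
    LinearMap.trace ℂ V (f ^ m) = Module.finrank ℂ V * μ ^ m := by
  induction m with
  | zero => simp
  | succ m ih =>
    rw [pow_succ, Module.End.mul_eq_comp,
      LinearMap.trace_comp_eq_mul_of_commute_of_isNilpotent μ (Commute.pow_left rfl m) hf, ih]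
    ring

/-- The power sums of the roots of the characteristic polynomial are the traces of the powers. -/
theorem trace_pow_eq_sum_roots_charpoly (f : Module.End ℂ V) (m : ℕ) :
    LinearMap.trace ℂ V (f ^ m) = (f.charpoly.roots.map (· ^ m)).sum := by
  classical
  have hint : DirectSum.IsInternal f.maxGenEigenspace :=
    DirectSum.isInternal_submodule_of_iSupIndep_of_iSup_eq_top
      f.independent_maxGenEigenspace (Module.End.iSup_maxGenEigenspace_eq_top f)
  have hroot : ∀ μ, f.maxGenEigenspace μ ≠ ⊥ ↔ μ ∈ f.charpoly.roots := by
    intro μ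
    rw [← Multiset.count_pos, Polynomial.count_roots, ← LinearMap.finrank_maxGenEigenspace_eq,
      Nat.pos_iff_ne_zero, Ne, Ne, Submodule.finrank_eq_zero]
  have hfin : {μ | f.maxGenEigenspace μ ≠ ⊥}.Finite := by
    refine f.charpoly.roots.toFinset.finite_toSet.subset fun μ hμ => ?_
    simpa using (hroot μ).1 hμ
  have hs : hfin.toFinset = f.charpoly.roots.toFinset := by
    ext μ
    rw [Set.Finite.mem_toFinset, Multiset.mem_toFinset]
    exact hroot μ
  have hmaps : ∀ μ, Set.MapsTo (f ^ m) (f.maxGenEigenspace μ) (f.maxGenEigenspace μ) := fun μ =>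
    Module.End.mapsTo_maxGenEigenspace_of_comm (Commute.pow_right rfl m) μ
  have hmaps1 : ∀ μ, Set.MapsTo f (f.maxGenEigenspace μ) (f.maxGenEigenspace μ) := fun μ =>
    Module.End.mapsTo_maxGenEigenspace_of_comm (Commute.refl f) μ
  rw [LinearMap.trace_eq_sum_trace_restrict' hint hfin hmaps, hs, Finset.sum_multiset_map_count]
  refine Finset.sum_congr rfl fun μ _ => ?_
  have hpow : (f ^ m).restrict (hmaps μ) = (f.restrict (hmaps1 μ)) ^ m :=
    (Module.End.pow_restrict m (hmaps1 μ)).symm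
  rw [hpow, trace_pow_of_isNilpotent_sub _ μ, LinearMap.finrank_maxGenEigenspace_eq,
    Polynomial.count_roots, nsmul_eq_mul]
  exact f.isNilpotent_restrict_maxGenEigenspace_sub_algebraMap μ

theorem det_one_add_eq_prod_roots_charpoly (f : Module.End ℂ V) :
    LinearMap.det (1 + f) = (f.charpoly.roots.map (1 + ·)).prod := by
  have hsp := IsAlgClosed.splits f.charpoly
  have h := LinearMap.eval_charpoly f (-1)
  have h1 : algebraMap ℂ (V →ₗ[ℂ] V) (-1) - f = (-1 : ℂ) • (1 + f) := by
    rw [map_neg, map_one, smul_add, neg_one_smul, neg_one_smul, sub_eq_add_neg]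
  rw [h1, LinearMap.det_smul, hsp.eq_prod_roots_of_monic f.charpoly_monic,
    Polynomial.eval_multiset_prod, Multiset.map_map] at h
  have hcard : f.charpoly.roots.card = Module.finrank ℂ V := by
    rw [← hsp.natDegree_eq_card_roots, LinearMap.charpoly_natDegree]
  have h2 : (f.charpoly.roots.map
      (Polynomial.eval (-1 : ℂ) ∘ fun a => Polynomial.X - Polynomial.C a)).prod
      = (-1) ^ Module.finrank ℂ V * (f.charpoly.roots.map (1 + ·)).prod := by
    rw [← hcard]
    induction f.charpoly.roots using Multiset.induction_on with
    | empty => simp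
    | cons a R ih =>
      rw [Multiset.map_cons, Multiset.prod_cons, ih, Multiset.map_cons, Multiset.prod_cons,
        Multiset.card_cons, pow_succ]
      simp only [Function.comp_apply, Polynomial.eval_sub, Polynomial.eval_X, Polynomial.eval_C]
      ring
  rw [h2] at h
  exact (mul_left_cancel₀ (pow_ne_zero _ (by norm_num)) h).symm

/-- Plemelj's formula in finite dimension. -/
theorem hasSum_plemelj_of_finiteDimensional (f : Module.End ℂ V)
    (hf : ∀ μ, f.HasEigenvalue μ → ‖μ‖ < 1) :
    ∃ s, HasSum (fun m : ℕ => (-1) ^ (m + 1 + 1) / ((m + 1 : ℕ) : ℂ) *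
      LinearMap.trace ℂ V (f ^ (m + 1))) s ∧ LinearMap.det (1 + f) = Complex.exp s := by
  have hroots : ∀ μ ∈ f.charpoly.roots, ‖μ‖ < 1 := fun μ hμ =>
    hf μ ((Module.End.hasEigenvalue_iff_isRoot_charpoly f μ).2 (Polynomial.isRoot_of_mem_roots hμ))
  simp only [trace_pow_eq_sum_roots_charpoly, det_one_add_eq_prod_roots_charpoly]
  generalize f.charpoly.roots = R at hroots
  induction R using Multiset.induction_on with
  | empty => exact ⟨0, by simp, by simp⟩
  | cons a R ih =>
    obtain ⟨s, hs, hs'⟩ := ih fun μ hμ => hroots μ (Multiset.mem_cons_of_mem hμ)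
    have ha : ‖a‖ < 1 := hroots a (Multiset.mem_cons_self a R)
    refine ⟨Complex.log (1 + a) + s, ?_, ?_⟩
    · have hlog := (hasSum_nat_add_iff' 1).2 (Complex.hasSum_taylorSeries_log ha)
      simp only [Finset.range_one, Finset.sum_singleton, Nat.cast_zero, div_zero, sub_zero] at hlog
      refine (hlog.add hs).congr_fun fun m => ?_
      rw [Multiset.map_cons, Multiset.sum_cons]
      ring
    · have h0 : 1 + a ≠ 0 := fun h => by
        rw [← neg_eq_of_add_eq_zero_right h] at ha
        simp at ha
      rw [Multiset.map_cons, Multiset.prod_cons, Complex.exp_add, Complex.exp_log h0, hs']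

end FiniteDimensional

section PoincareAlgebra

variable {n : ℕ}

theorem latticeL2_hasSum_single (φ : LatticeL2 n) :
    HasSum (fun k => φ k • (lp.single 2 k 1 : LatticeL2 n)) φ := by
  refine (lp.hasSum_single (by norm_num) φ).congr_fun fun k => ?_
  rw [← lp.single_smul, smul_eq_mul, mul_one]

theorem hasSum_matrixEntry_mul (A : LatticeL2 n →L[ℂ] LatticeL2 n) (φ : LatticeL2 n)
    (j : IntLattice n) : HasSum (fun k => matrixEntry A j k * φ k) (A φ j) := by
  have h := ((latticeL2_hasSum_single φ).mapL A).mapL (lp.evalCLM ℂ (fun _ => ℂ) 2 j)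
  refine h.congr_fun fun k => ?_
  rw [map_smul, map_smul, smul_eq_mul, mul_comm]
  rfl

theorem matrixEntry_ext {A B : LatticeL2 n →L[ℂ] LatticeL2 n}
    (h : ∀ j k, matrixEntry A j k = matrixEntry B j k) : A = B := by
  ext φ j
  refine (hasSum_matrixEntry_mul A φ j).unique ?_
  simpa only [h] using hasSum_matrixEntry_mul B φ j

theorem matrixEntry_sub (A B : LatticeL2 n →L[ℂ] LatticeL2 n) (j k : IntLattice n) :
    matrixEntry (A - B) j k = matrixEntry A j k - matrixEntry B j k := rfl

theorem matrixEntry_smul (z : ℂ) (A : LatticeL2 n →L[ℂ] LatticeL2 n) (j k : IntLattice n) :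
    matrixEntry (z • A) j k = z * matrixEntry A j k := rfl

theorem hasSum_matrixEntry_comp (A B : LatticeL2 n →L[ℂ] LatticeL2 n) (j k : IntLattice n) :
    HasSum (fun l => matrixEntry A j l * matrixEntry B l k) (matrixEntry (A * B) j k) :=
  hasSum_matrixEntry_mul A (B (lp.single 2 k 1)) j

/-- The norm of `𝒟₂` with values in `[0, ∞]`. -/
noncomputable def poincareENorm (A : LatticeL2 n →L[ℂ] LatticeL2 n) : ENNReal :=
  ∑' p : IntLattice n × IntLattice n, ‖matrixEntry A p.1 p.2‖ₑ

theorem mem_poincareAlgebra_iff {A : LatticeL2 n →L[ℂ] LatticeL2 n} :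
    A ∈ poincareAlgebra n ↔ poincareENorm A ≠ ⊤ :=
  tsum_enorm_ne_top_iff_summable_norm.symm

theorem ofReal_poincareNorm {A : LatticeL2 n →L[ℂ] LatticeL2 n} (hA : A ∈ poincareAlgebra n) :
    ENNReal.ofReal (poincareNorm A) = poincareENorm A := by
  rw [poincareNorm, ENNReal.ofReal_tsum_of_nonneg (fun _ => norm_nonneg _) hA]
  simp only [ofReal_norm, poincareENorm]

theorem poincareNorm_eq_toReal (A : LatticeL2 n →L[ℂ] LatticeL2 n) :
    poincareNorm A = (poincareENorm A).toReal := by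
  simp [poincareNorm, poincareENorm, ENNReal.tsum_toReal_eq]

theorem poincareENorm_add_le (A B : LatticeL2 n →L[ℂ] LatticeL2 n) :
    poincareENorm (A + B) ≤ poincareENorm A + poincareENorm B := by
  rw [poincareENorm, poincareENorm, poincareENorm, ← ENNReal.tsum_add]
  exact ENNReal.tsum_le_tsum fun p => enorm_add_le _ _

theorem poincareENorm_smul (z : ℂ) (A : LatticeL2 n →L[ℂ] LatticeL2 n) :
    poincareENorm (z • A) = ‖z‖ₑ * poincareENorm A := by
  simp only [poincareENorm, matrixEntry_smul, enorm_mul, ENNReal.tsum_mul_left]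

theorem poincareENorm_mul_le (A B : LatticeL2 n →L[ℂ] LatticeL2 n) :
    poincareENorm (A * B) ≤ poincareENorm A * poincareENorm B := by
  calc poincareENorm (A * B)
      ≤ ∑' (j) (k) (l), ‖matrixEntry A j l‖ₑ * ‖matrixEntry B l k‖ₑ := by
        rw [poincareENorm, ENNReal.tsum_prod']
        refine ENNReal.tsum_le_tsum fun j => ENNReal.tsum_le_tsum fun k => ?_
        rw [← (hasSum_matrixEntry_comp A B j k).tsum_eq]
        refine enorm_tsum_le_tsum_enorm.trans (le_of_eq ?_)
        simp only [enorm_mul]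
    _ = ∑' (j) (l), ‖matrixEntry A j l‖ₑ * ∑' k, ‖matrixEntry B l k‖ₑ := by
        refine tsum_congr fun j => ?_
        rw [ENNReal.tsum_comm]
        simp only [ENNReal.tsum_mul_left]
    _ ≤ ∑' (j) (l), ‖matrixEntry A j l‖ₑ * poincareENorm B := by
        refine ENNReal.tsum_le_tsum fun j => ENNReal.tsum_le_tsum fun l => ?_
        gcongr
        rw [poincareENorm, ENNReal.tsum_prod']
        exact ENNReal.le_tsum l
    _ = poincareENorm A * poincareENorm B := by
        simp only [ENNReal.tsum_mul_right]
        rw [← ENNReal.tsum_prod (f := fun j l => ‖matrixEntry A j l‖ₑ)]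
        rfl

/-- The operator on `ℓ²(ℤⁿ)` with matrix entry `1` at `p` and `0` elsewhere. -/
noncomputable def matrixUnit (p : IntLattice n × IntLattice n) : LatticeL2 n →L[ℂ] LatticeL2 n :=
  (lp.singleContinuousLinearMap ℂ (fun _ => ℂ) 2 p.1).comp (lp.evalCLM ℂ (fun _ => ℂ) 2 p.2)

theorem matrixUnit_apply (p : IntLattice n × IntLattice n) (φ : LatticeL2 n) :
    matrixUnit p φ = lp.single 2 p.1 (φ p.2) := rfl

theorem matrixEntry_matrixUnit (p q : IntLattice n × IntLattice n) :
    matrixEntry (matrixUnit p) q.1 q.2 = if q = p then 1 else 0 := by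
  rw [matrixEntry, matrixUnit_apply, lp.single_apply, lp.single_apply, Pi.single_apply,
    Pi.single_apply]
  by_cases h : q = p
  · simp [h]
  · rw [if_neg h]
    rw [Prod.ext_iff, not_and_or] at h
    rcases h with h | h
    · simp [h]
    · simp [Ne.symm h]

theorem norm_matrixUnit_le (p : IntLattice n × IntLattice n) : ‖matrixUnit p‖ ≤ 1 := by
  refine ContinuousLinearMap.opNorm_le_bound _ zero_le_one fun φ => ?_
  rw [one_mul, matrixUnit_apply, lp.norm_single (by norm_num)]
  exact lp.norm_apply_le_norm (by norm_num) φ p.2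

theorem finiteDimensional_range_matrixUnit (p : IntLattice n × IntLattice n) :
    FiniteDimensional ℂ (matrixUnit p : LatticeL2 n →ₗ[ℂ] LatticeL2 n).range := by
  refine Submodule.finiteDimensional_of_le (S₂ := ℂ ∙ (lp.single 2 p.1 1 : LatticeL2 n)) ?_
  rintro _ ⟨φ, rfl⟩
  refine Submodule.mem_span_singleton.2 ⟨φ p.2, ?_⟩
  rw [← lp.single_smul, smul_eq_mul, mul_one]
  rfl

/-- The matrix entry as a continuous linear functional. -/
noncomputable def matrixEntryCLM (j k : IntLattice n) : (LatticeL2 n →L[ℂ] LatticeL2 n) →L[ℂ] ℂ :=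
  (lp.evalCLM ℂ (fun _ => ℂ) 2 j).comp (ContinuousLinearMap.apply ℂ _ (lp.single 2 k 1))

theorem matrixEntryCLM_apply (A : LatticeL2 n →L[ℂ] LatticeL2 n) (j k : IntLattice n) :
    matrixEntryCLM j k A = matrixEntry A j k := rfl

theorem summable_smul_matrixUnit {a : IntLattice n × IntLattice n → ℂ}
    (ha : Summable fun p => ‖a p‖) : Summable fun p => ‖a p • matrixUnit p‖ := by
  refine ha.of_nonneg_of_le (fun _ => norm_nonneg _) fun p => ?_
  rw [norm_smul]
  exact mul_le_of_le_one_right (norm_nonneg _) (norm_matrixUnit_le p)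

theorem matrixEntry_tsum_smul_matrixUnit {a : IntLattice n × IntLattice n → ℂ}
    (ha : Summable fun p => ‖a p‖) (q : IntLattice n × IntLattice n) :
    matrixEntry (∑' p, a p • matrixUnit p) q.1 q.2 = a q := by
  rw [← matrixEntryCLM_apply, ContinuousLinearMap.map_tsum _ (summable_smul_matrixUnit ha).of_norm,
    tsum_eq_single q]
  · rw [map_smul, matrixEntryCLM_apply, matrixEntry_matrixUnit, if_pos rfl, smul_eq_mul, mul_one]
  · intro p hp
    rw [map_smul, matrixEntryCLM_apply, matrixEntry_matrixUnit, if_neg hp.symm, smul_zero]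

theorem exists_mem_poincareAlgebra {a : IntLattice n × IntLattice n → ℂ}
    (ha : Summable fun p => ‖a p‖) :
    ∃ A ∈ poincareAlgebra n, ∀ j k, matrixEntry A j k = a (j, k) :=
  ⟨∑' p, a p • matrixUnit p, by
    simpa only [poincareAlgebra, Set.mem_ofPred_eq, matrixEntry_tsum_smul_matrixUnit ha],
    fun j k => matrixEntry_tsum_smul_matrixUnit ha (j, k)⟩

theorem norm_le_poincareNorm {A : LatticeL2 n →L[ℂ] LatticeL2 n} (hA : A ∈ poincareAlgebra n) :
    ‖A‖ ≤ poincareNorm A := by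
  have h : A = ∑' p : IntLattice n × IntLattice n, matrixEntry A p.1 p.2 • matrixUnit p :=
    matrixEntry_ext fun j k => (matrixEntry_tsum_smul_matrixUnit hA (j, k)).symm
  calc ‖A‖ = ‖∑' p : IntLattice n × IntLattice n, matrixEntry A p.1 p.2 • matrixUnit p‖ := by
        rw [← h]
    _ ≤ ∑' p : IntLattice n × IntLattice n, ‖matrixEntry A p.1 p.2 • matrixUnit p‖ :=
        norm_tsum_le_tsum_norm (summable_smul_matrixUnit hA)
    _ ≤ poincareNorm A := by
        refine (summable_smul_matrixUnit hA).tsum_le_tsum (fun p => ?_) hA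
        rw [norm_smul]
        exact mul_le_of_le_one_right (norm_nonneg _) (norm_matrixUnit_le p)

/-- Finite rank operators are dense in `𝒟₂`. -/
theorem finiteRankApprox_neBot (A : LatticeL2 n →L[ℂ] LatticeL2 n) :
    (finiteRankApprox A).NeBot := by
  classical
  let F : Finset (IntLattice n × IntLattice n) → LatticeL2 n →L[ℂ] LatticeL2 n :=
    fun s => ∑ p ∈ s, matrixEntry A p.1 p.2 • matrixUnit p
  have hF : ∀ s q, matrixEntry (F s) q.1 q.2 = if q ∈ s then matrixEntry A q.1 q.2 else 0 := by
    intro s q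
    simp only [F]
    rw [← matrixEntryCLM_apply, map_sum]
    simp [matrixEntryCLM_apply, matrixEntry_matrixUnit]
  have hmem : ∀ s, F s ∈ poincareFiniteRank n := by
    refine fun s => ⟨summable_of_hasFiniteSupport (s.finite_toSet.subset fun q hq => ?_), ?_⟩
    · by_contra h
      exact hq (by simp [hF, show q ∉ s from h])
    · refine s.sum_induction (fun p => matrixEntry A p.1 p.2 • matrixUnit p)
        (fun T => FiniteDimensional ℂ (T : LatticeL2 n →ₗ[ℂ] LatticeL2 n).range) ?_ ?_ ?_
      · intro S T hS hT
        exact Submodule.finiteDimensional_of_le (LinearMap.range_add_le _ _)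
      · have : ((0 : LatticeL2 n →L[ℂ] LatticeL2 n) : LatticeL2 n →ₗ[ℂ] LatticeL2 n).range = ⊥ :=
          LinearMap.range_zero
        rw [this]
        infer_instance
      · intro p _
        have := finiteDimensional_range_matrixUnit p
        refine Submodule.finiteDimensional_of_le
          (S₂ := (matrixUnit p : LatticeL2 n →ₗ[ℂ] LatticeL2 n).range) ?_
        rintro _ ⟨x, rfl⟩
        exact ⟨matrixEntry A p.1 p.2 • x, by simp⟩
  have hlim : Tendsto (fun s => poincareNorm (F s - A)) atTop (𝓝 0) := by
    refine (tendsto_tsum_compl_atTop_zero fun q : IntLattice n × IntLattice n =>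
      ‖matrixEntry A q.1 q.2‖).congr fun s => ?_
    rw [poincareNorm]
    refine (tsum_subtype {q | q ∉ s} fun q : IntLattice n × IntLattice n =>
      ‖matrixEntry A q.1 q.2‖).trans (tsum_congr fun q => ?_)
    rw [matrixEntry_sub, hF]
    by_cases h : q ∈ s <;> simp [h]
  have : Tendsto F atTop (finiteRankApprox A) :=
    tendsto_inf.2 ⟨tendsto_comap_iff.2 hlim, tendsto_principal.2 (Eventually.of_forall hmem)⟩
  exact this.neBot

/-- The trace of a matrix. -/
noncomputable def matrixTrace (A : LatticeL2 n →L[ℂ] LatticeL2 n) : ℂ := ∑' k, matrixEntry A k k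

theorem enorm_matrixTrace_le (A : LatticeL2 n →L[ℂ] LatticeL2 n) :
    ‖matrixTrace A‖ₑ ≤ poincareENorm A := by
  refine enorm_tsum_le_tsum_enorm.trans ?_
  rw [poincareENorm, ENNReal.tsum_prod']
  exact ENNReal.tsum_le_tsum fun k => ENNReal.le_tsum (f := fun l => ‖matrixEntry A k l‖ₑ) k

theorem summable_matrixEntry_diag {A : LatticeL2 n →L[ℂ] LatticeL2 n}
    (hA : A ∈ poincareAlgebra n) : Summable fun k => matrixEntry A k k :=
  Summable.of_norm (hA.comp_injective (i := fun k => (k, k)) fun _ _ h => congrArg Prod.fst h)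

theorem matrixTrace_sub {A B : LatticeL2 n →L[ℂ] LatticeL2 n} (hA : A ∈ poincareAlgebra n)
    (hB : B ∈ poincareAlgebra n) : matrixTrace (A - B) = matrixTrace A - matrixTrace B :=
  (summable_matrixEntry_diag hA).tsum_sub (summable_matrixEntry_diag hB)

theorem matrixTrace_smul (z : ℂ) (A : LatticeL2 n →L[ℂ] LatticeL2 n) :
    matrixTrace (z • A) = z * matrixTrace A :=
  tsum_mul_left

theorem poincareENorm_pow_succ_le (A : LatticeL2 n →L[ℂ] LatticeL2 n) (m : ℕ) :
    poincareENorm (A ^ (m + 1)) ≤ poincareENorm A ^ (m + 1) := by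
  induction m with
  | zero => simp
  | succ m ih =>
    rw [pow_succ A, pow_succ (poincareENorm A)]
    exact (poincareENorm_mul_le _ _).trans (by gcongr)

theorem pow_succ_mem_poincareAlgebra {A : LatticeL2 n →L[ℂ] LatticeL2 n}
    (hA : A ∈ poincareAlgebra n) (m : ℕ) : A ^ (m + 1) ∈ poincareAlgebra n := by
  rw [mem_poincareAlgebra_iff] at hA ⊢
  exact ((poincareENorm_pow_succ_le A m).trans_lt (ENNReal.pow_lt_top hA.lt_top)).ne

/-- The trace of an operator of finite rank is the sum of the diagonal of its matrix. -/
theorem hasSum_matrixEntry_diag_of_range_le (B : LatticeL2 n →L[ℂ] LatticeL2 n)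
    (R : Submodule ℂ (LatticeL2 n)) [FiniteDimensional ℂ R] (hB : ∀ x, B x ∈ R) :
    HasSum (fun k => matrixEntry B k k)
      (LinearMap.trace ℂ R ((B : LatticeL2 n →ₗ[ℂ] LatticeL2 n).restrict
        (p := R) (q := R) fun x _ => hB x)) := by
  let b := Module.finBasis ℂ R
  let φ : Fin (Module.finrank ℂ R) → LatticeL2 n →L[ℂ] ℂ := fun i =>
    (LinearMap.toContinuousLinearMap (b.coord i)).comp (B.codRestrict R hB)
  have hBφ : ∀ x, B x = ∑ i, φ i x • (b i : LatticeL2 n) := by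
    intro x
    have h := congrArg Subtype.val (b.sum_repr ⟨B x, hB x⟩)
    rw [Submodule.coe_sum] at h
    exact h.symm
  have htr : LinearMap.trace ℂ R ((B : LatticeL2 n →ₗ[ℂ] LatticeL2 n).restrict
      (p := R) (q := R) fun x _ => hB x) = ∑ i, φ i (b i) := by
    rw [LinearMap.trace_eq_matrix_trace ℂ b]
    refine Finset.sum_congr rfl fun i _ => ?_
    rw [Matrix.diag_apply, LinearMap.toMatrix_apply]
    rfl
  rw [htr]
  have hφ : ∀ i, HasSum (fun k => (b i : LatticeL2 n) k * φ i (lp.single 2 k 1)) (φ i (b i)) := by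
    intro i
    refine ((latticeL2_hasSum_single (b i : LatticeL2 n)).mapL (φ i)).congr_fun fun k => ?_
    rw [map_smul, smul_eq_mul]
  refine (hasSum_sum fun i _ => hφ i).congr_fun fun k => ?_
  have h := congrArg (lp.evalCLM ℂ (fun _ : IntLattice n => ℂ) 2 k) (hBφ (lp.single 2 k 1))
  rw [map_sum] at h
  refine h.trans (Finset.sum_congr rfl fun i _ => ?_)
  rw [map_smul, smul_eq_mul, mul_comm]
  rfl

end PoincareAlgebra

section ChainSums

/-- The product of the weights `b (j s) (j (s + 1))` along a chain `j`. -/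
def chainWeight {ι M : Type*} [CommMonoid M] (b : ι → ι → M) {m : ℕ} (j : Fin (m + 1) → ι) : M :=
  ∏ s : Fin m, b (j s.castSucc) (j s.succ)

theorem chainWeight_cons {ι M : Type*} [CommMonoid M] (b : ι → ι → M) {m : ℕ} (i : ι)
    (j : Fin (m + 1) → ι) :
    chainWeight b (Fin.cons i j : Fin (m + 2) → ι) = b i (j 0) * chainWeight b j := by
  rw [chainWeight, Fin.prod_univ_succ]
  rfl

theorem tsum_chain_cons {ι : Type*} {m : ℕ} (g : (Fin (m + 1) → ι) → ENNReal) :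
    ∑' j, g j = ∑' (i) (j : Fin m → ι), g (Fin.cons i j) := by
  rw [← (Fin.consEquiv fun _ : Fin (m + 1) => ι).tsum_eq g, ENNReal.tsum_prod']
  rfl

theorem tsum_chain_cons_of_summable {ι : Type*} {m : ℕ} {g : (Fin (m + 1) → ι) → ℂ}
    (hg : Summable g) : ∑' j, g j = ∑' (i) (j : Fin m → ι), g (Fin.cons i j) := by
  have h := ((Fin.consEquiv fun _ : Fin (m + 1) => ι).summable_iff).2 hg
  rw [← (Fin.consEquiv fun _ : Fin (m + 1) => ι).tsum_eq g]
  exact h.tsum_prod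

theorem tsum_chainWeight_cons_le {ι : Type*} (b : ι → ι → ENNReal) (m : ℕ) (i : ι) :
    ∑' j : Fin m → ι, chainWeight b (Fin.cons i j : Fin (m + 1) → ι) ≤ (∑' (j) (k), b j k) ^ m := by
  induction m generalizing i with
  | zero => simp [chainWeight]
  | succ m ih =>
    simp only [chainWeight_cons]
    rw [tsum_chain_cons]
    simp only [Fin.cons_zero, ENNReal.tsum_mul_left]
    calc ∑' k, b i k * ∑' j : Fin m → ι, chainWeight b (Fin.cons k j : Fin (m + 1) → ι)
        ≤ ∑' k, b i k * (∑' (j) (k), b j k) ^ m := ENNReal.tsum_le_tsum fun k => by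
          gcongr
          exact ih k
      _ ≤ (∑' (j) (k), b j k) * (∑' (j) (k), b j k) ^ m := by
          rw [ENNReal.tsum_mul_right]
          exact mul_le_mul_left (ENNReal.le_tsum (f := fun j => ∑' k, b j k) i) _
      _ = _ := (pow_succ' _ m).symm

theorem tsum_chainWeight_le {ι : Type*} (b : ι → ι → ENNReal) (m : ℕ) :
    ∑' j : Fin (m + 2) → ι, chainWeight b j ≤ (∑' (j) (k), b j k) ^ (m + 1) := by
  rw [tsum_chain_cons]
  simp only [chainWeight_cons]
  calc ∑' (i) (j : Fin (m + 1) → ι), b i (j 0) * chainWeight b j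
      = ∑' (i) (k), b i k * ∑' j : Fin m → ι, chainWeight b (Fin.cons k j : Fin (m + 1) → ι) := by
        refine tsum_congr fun i => ?_
        rw [tsum_chain_cons]
        simp only [Fin.cons_zero, ENNReal.tsum_mul_left]
    _ ≤ ∑' (i) (k), b i k * (∑' (j) (k), b j k) ^ m :=
        ENNReal.tsum_le_tsum fun i => ENNReal.tsum_le_tsum fun k => by
          gcongr
          exact tsum_chainWeight_cons_le b m k
    _ = (∑' (j) (k), b j k) ^ (m + 1) := by
        simp only [ENNReal.tsum_mul_right]
        exact (pow_succ' _ m).symm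

theorem enorm_chainWeight {ι : Type*} (a : ι → ι → ℂ) {m : ℕ} (j : Fin (m + 1) → ι) :
    ‖chainWeight a j‖ₑ = chainWeight (fun i k => ‖a i k‖ₑ) j := by
  simp only [chainWeight, enorm_eq_nnnorm, nnnorm_prod, ENNReal.ofNNReal_finsetProd]

variable {n : ℕ} {A : LatticeL2 n →L[ℂ] LatticeL2 n}

theorem poincareENorm_eq_tsum_tsum (A : LatticeL2 n →L[ℂ] LatticeL2 n) :
    poincareENorm A = ∑' (j) (k), ‖matrixEntry A j k‖ₑ :=
  ENNReal.tsum_prod'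

theorem summable_chainWeight_cons (hA : A ∈ poincareAlgebra n) (m : ℕ) (i : IntLattice n) :
    Summable fun j : Fin m → IntLattice n =>
      ‖chainWeight (matrixEntry A) (Fin.cons i j : Fin (m + 1) → IntLattice n)‖ := by
  rw [← tsum_enorm_ne_top_iff_summable_norm]
  simp only [enorm_chainWeight]
  refine ((tsum_chainWeight_cons_le _ m i).trans_lt (ENNReal.pow_lt_top ?_)).ne
  rw [← poincareENorm_eq_tsum_tsum]
  exact (mem_poincareAlgebra_iff.1 hA).lt_top

theorem summable_chainWeight (hA : A ∈ poincareAlgebra n) (m : ℕ) :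
    Summable fun j : Fin (m + 2) → IntLattice n => ‖chainWeight (matrixEntry A) j‖ := by
  rw [← tsum_enorm_ne_top_iff_summable_norm]
  simp only [enorm_chainWeight]
  refine ((tsum_chainWeight_le _ m).trans_lt (ENNReal.pow_lt_top ?_)).ne
  rw [← poincareENorm_eq_tsum_tsum]
  exact (mem_poincareAlgebra_iff.1 hA).lt_top

/-- The powers of an operator in `𝒟₂` as sums over chains. -/
theorem pow_apply_eq_tsum_chainWeight (hA : A ∈ poincareAlgebra n) (m : ℕ) (φ : LatticeL2 n)
    (i : IntLattice n) :
    (A ^ m) φ i = ∑' j : Fin m → IntLattice n,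
      chainWeight (matrixEntry A) (Fin.cons i j : Fin (m + 1) → IntLattice n) *
        φ ((Fin.cons i j : Fin (m + 1) → IntLattice n) (Fin.last m)) := by
  induction m generalizing i with
  | zero => simp [chainWeight]
  | succ m ih =>
    have hsum : Summable fun j : Fin (m + 1) → IntLattice n =>
        chainWeight (matrixEntry A) (Fin.cons i j : Fin (m + 2) → IntLattice n) *
          φ ((Fin.cons i j : Fin (m + 2) → IntLattice n) (Fin.last (m + 1))) := by
      refine Summable.of_norm_bounded ((summable_chainWeight_cons hA (m + 1) i).mul_right ‖φ‖)
        fun j => ?_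
      rw [norm_mul]
      gcongr
      exact lp.norm_apply_le_norm (by norm_num) φ _
    rw [tsum_chain_cons_of_summable hsum, pow_succ', mul_apply_eq_comp,
      ← (hasSum_matrixEntry_mul A _ i).tsum_eq]
    refine tsum_congr fun k => ?_
    rw [ih k, ← tsum_mul_left]
    refine tsum_congr fun j => ?_
    rw [chainWeight_cons, Fin.cons_zero, mul_assoc]
    rfl

theorem summable_closedChain (hA : A ∈ poincareAlgebra n) (m : ℕ) :
    Summable fun j : ClosedChain n (m + 1) => chainWeight (matrixEntry A) j.1 :=
  (summable_chainWeight hA m).of_norm.subtype _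

/-- The trace of a power of an operator in `𝒟₂` as a sum over closed chains. -/
theorem matrixTrace_pow_succ (hA : A ∈ poincareAlgebra n) (m : ℕ) :
    matrixTrace (A ^ (m + 1)) = ∑' j : ClosedChain n (m + 1), chainWeight (matrixEntry A) j.1 := by
  refine Eq.trans ?_ (tsum_subtype {j : Fin (m + 2) → IntLattice n | j 0 = j (Fin.last (m + 1))}
    (chainWeight (matrixEntry A))).symm
  rw [tsum_chain_cons_of_summable ((summable_chainWeight hA m).of_norm.indicator _)]
  refine tsum_congr fun i => ?_
  rw [matrixEntry, pow_apply_eq_tsum_chainWeight hA]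
  refine tsum_congr fun j => ?_
  rw [Set.indicator_apply, lp.single_apply, Pi.single_apply, mul_ite, mul_one, mul_zero]
  simp only [Set.mem_ofPred_eq, Fin.cons_zero, eq_comm]

end ChainSums

section Plemelj

variable {n : ℕ}

/-- The coefficient `(-1)^(m+2) / (m+1)` of the logarithmic series. -/
noncomputable def logCoeff (m : ℕ) : ℂ := (-1) ^ (m + 1 + 1) / ((m + 1 : ℕ) : ℂ)

theorem norm_logCoeff_le (m : ℕ) : ‖logCoeff m‖ ≤ 1 := by
  rw [logCoeff, norm_div, norm_pow, norm_neg, norm_one, one_pow, Complex.norm_natCast]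
  exact div_le_one_of_le₀ (by exact_mod_cast Nat.succ_pos m) (Nat.cast_nonneg _)

theorem norm_matrixTrace_pow_le {A : LatticeL2 n →L[ℂ] LatticeL2 n} {r : NNReal}
    (hA : poincareENorm A ≤ r) (m : ℕ) : ‖matrixTrace (A ^ (m + 1))‖ ≤ (r : ℝ) ^ (m + 1) := by
  have h : ‖matrixTrace (A ^ (m + 1))‖ₑ ≤ ((r ^ (m + 1) : NNReal) : ENNReal) := by
    rw [ENNReal.coe_pow]
    exact (enorm_matrixTrace_le _).trans ((poincareENorm_pow_succ_le A m).trans (by gcongr))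
  rw [enorm_eq_nnnorm, ENNReal.coe_le_coe, ← NNReal.coe_le_coe] at h
  exact_mod_cast h

theorem norm_logCoeff_mul_matrixTrace_le {A : LatticeL2 n →L[ℂ] LatticeL2 n} {r : NNReal}
    (hA : poincareENorm A ≤ r) (m : ℕ) :
    ‖logCoeff m * matrixTrace (A ^ (m + 1))‖ ≤ (r : ℝ) ^ (m + 1) := by
  rw [norm_mul]
  exact (mul_le_of_le_one_left (norm_nonneg _) (norm_logCoeff_le m)).trans
    (norm_matrixTrace_pow_le hA m)

theorem finiteRankDet_eq_exp {F : LatticeL2 n →L[ℂ] LatticeL2 n} (hF : F ∈ poincareFiniteRank n)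
    (hF1 : poincareNorm F < 1) :
    finiteRankDet (F : LatticeL2 n →ₗ[ℂ] LatticeL2 n)
      = Complex.exp (∑' m, logCoeff m * matrixTrace (F ^ (m + 1))) := by
  obtain ⟨hFD, hfin⟩ := hF
  set F' : LatticeL2 n →ₗ[ℂ] LatticeL2 n := (F : LatticeL2 n →ₗ[ℂ] LatticeL2 n) with hF'
  set f : Module.End ℂ F'.range :=
    F'.restrict (p := F'.range) (q := F'.range) (fun x _ => ⟨x, rfl⟩) with hf
  have heig : ∀ μ, f.HasEigenvalue μ → ‖μ‖ < 1 := by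
    intro μ hμ
    obtain ⟨v, hv⟩ := hμ.exists_hasEigenvector
    have hv0 : (v : LatticeL2 n) ≠ 0 := fun h => hv.2 (Subtype.ext h)
    have h1 : F v = μ • (v : LatticeL2 n) := congrArg Subtype.val hv.apply_eq_smul
    have h2 := F.le_opNorm v
    rw [h1, norm_smul] at h2
    exact (le_of_mul_le_mul_right h2 (norm_pos_iff.2 hv0)).trans_lt
      ((norm_le_poincareNorm hFD).trans_lt hF1)
  obtain ⟨s, hs, hdet⟩ := hasSum_plemelj_of_finiteDimensional f heig
  have htr : ∀ m, LinearMap.trace ℂ F'.range (f ^ (m + 1)) = matrixTrace (F ^ (m + 1)) := by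
    intro m
    have hmem : ∀ x, (F ^ (m + 1)) x ∈ F'.range := fun x => by
      rw [pow_succ']
      exact ⟨(F ^ m) x, rfl⟩
    rw [matrixTrace, (hasSum_matrixEntry_diag_of_range_le (F ^ (m + 1)) F'.range hmem).tsum_eq]
    congr 1
    refine (Module.End.pow_restrict (m + 1) _).trans ?_
    ext x
    simp only [LinearMap.restrict_apply, hF', ContinuousLinearMap.toLinearMap_pow]
  simp only [htr] at hs
  rw [finiteRankDet, ← hf, hdet, ← hs.tsum_eq]
  rfl

theorem tendsto_poincareENorm_sub (A : LatticeL2 n →L[ℂ] LatticeL2 n) (hA : A ∈ poincareAlgebra n) :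
    Tendsto (fun F => poincareENorm (F - A)) (finiteRankApprox A) (𝓝 0) := by
  have h : Tendsto (fun F => poincareNorm (F - A)) (finiteRankApprox A) (𝓝 0) :=
    tendsto_comap.mono_left inf_le_left
  have h' := ENNReal.tendsto_ofReal h
  rw [ENNReal.ofReal_zero] at h'
  refine h'.congr' ?_
  have hfin : ∀ᶠ F in finiteRankApprox A, F ∈ poincareFiniteRank n :=
    Eventually.filter_mono inf_le_right (mem_principal_self _)
  filter_upwards [hfin] with F hF
  refine ofReal_poincareNorm ?_
  rw [mem_poincareAlgebra_iff] at hA ⊢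
  rw [sub_eq_add_neg, ← neg_one_smul ℂ A]
  refine ((poincareENorm_add_le F _).trans_lt (ENNReal.add_lt_top.2
    ⟨(mem_poincareAlgebra_iff.1 hF.1).lt_top, ?_⟩)).ne
  rw [poincareENorm_smul, enorm_neg, enorm_one, one_mul]
  exact hA.lt_top

/-- The Poincaré determinant of `I + A` is given by Plemelj's formula if `‖A‖ < 1` in `𝒟₂`. -/
theorem hasPoincareDet_of_poincareNorm_lt_one {A : LatticeL2 n →L[ℂ] LatticeL2 n}
    (hA : A ∈ poincareAlgebra n) (hA1 : poincareNorm A < 1) :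
    (Summable fun m => logCoeff m * matrixTrace (A ^ (m + 1))) ∧
    HasPoincareDet A (Complex.exp (∑' m, logCoeff m * matrixTrace (A ^ (m + 1)))) := by
  have hAtop := mem_poincareAlgebra_iff.1 hA
  have hAlt : poincareENorm A < 1 := by
    rw [← ofReal_poincareNorm hA]
    simpa using hA1
  obtain ⟨r, hr, hr1⟩ := ENNReal.lt_iff_exists_nnreal_btwn.1 hAlt
  have hr1' : (r : ℝ) < 1 := by exact_mod_cast hr1
  have hgeo : Summable fun m : ℕ => (r : ℝ) ^ (m + 1) :=
    (summable_nat_add_iff 1).2 (summable_geometric_of_lt_one r.2 hr1')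
  refine ⟨Summable.of_norm_bounded hgeo (norm_logCoeff_mul_matrixTrace_le hr.le), hA,
    finiteRankApprox_neBot A, ?_⟩
  have hfin : ∀ᶠ F in finiteRankApprox A, F ∈ poincareFiniteRank n :=
    Eventually.filter_mono inf_le_right (mem_principal_self _)
  have hsub := tendsto_poincareENorm_sub A hA
  have hle : ∀ᶠ F in finiteRankApprox A, poincareENorm F ≤ r := by
    have : Tendsto (fun F => poincareENorm (F - A) + poincareENorm A) (finiteRankApprox A)
        (𝓝 (0 + poincareENorm A)) := hsub.add_const _
    rw [zero_add] at this
    filter_upwards [this.eventually (gt_mem_nhds hr)] with F hF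
    calc poincareENorm F = poincareENorm ((F - A) + A) := by rw [sub_add_cancel]
      _ ≤ _ := poincareENorm_add_le _ _
      _ ≤ r := hF.le
  have hpow : ∀ m, Tendsto (fun F => poincareENorm (F ^ (m + 1) - A ^ (m + 1)))
      (finiteRankApprox A) (𝓝 0) := by
    intro m
    induction m with
    | zero => simpa using hsub
    | succ m ih =>
      have hb : Tendsto (fun F => (r : ENNReal) * poincareENorm (F ^ (m + 1) - A ^ (m + 1))
          + poincareENorm (F - A) * poincareENorm (A ^ (m + 1))) (finiteRankApprox A)
          (𝓝 (r * 0 + 0 * poincareENorm (A ^ (m + 1)))) := by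
        refine (ENNReal.Tendsto.const_mul ih (Or.inr ENNReal.coe_ne_top)).add
          (ENNReal.Tendsto.mul_const hsub (Or.inr ?_))
        exact mem_poincareAlgebra_iff.1 (pow_succ_mem_poincareAlgebra hA m)
      rw [mul_zero, zero_mul, zero_add] at hb
      refine tendsto_of_tendsto_of_tendsto_of_le_of_le' tendsto_const_nhds hb
        (Eventually.of_forall fun _ => zero_le) ?_
      filter_upwards [hle] with F hF
      have : F ^ (m + 1 + 1) - A ^ (m + 1 + 1)
          = F * (F ^ (m + 1) - A ^ (m + 1)) + (F - A) * A ^ (m + 1) := by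
        rw [pow_succ' F, pow_succ' A]
        noncomm_ring
      rw [this]
      refine (poincareENorm_add_le _ _).trans (add_le_add ?_ (poincareENorm_mul_le _ _))
      exact (poincareENorm_mul_le _ _).trans (by gcongr)
  have htrace : ∀ m, Tendsto (fun F => matrixTrace (F ^ (m + 1))) (finiteRankApprox A)
      (𝓝 (matrixTrace (A ^ (m + 1)))) := by
    intro m
    rw [tendsto_iff_enorm_sub_tendsto_zero]
    refine tendsto_of_tendsto_of_tendsto_of_le_of_le' tendsto_const_nhds (hpow m)
        (Eventually.of_forall fun _ => zero_le) ?_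
    filter_upwards [hfin] with F hF
    rw [← matrixTrace_sub (pow_succ_mem_poincareAlgebra hF.1 m) (pow_succ_mem_poincareAlgebra hA m)]
    exact enorm_matrixTrace_le _
  have hlim : Tendsto (fun F => ∑' m, logCoeff m * matrixTrace (F ^ (m + 1))) (finiteRankApprox A)
      (𝓝 (∑' m, logCoeff m * matrixTrace (A ^ (m + 1)))) := by
    refine tendsto_tsum_of_dominated_convergence hgeo (fun m => (htrace m).const_mul _) ?_
    filter_upwards [hle] with F hF
    exact norm_logCoeff_mul_matrixTrace_le hF
  refine ((Complex.continuous_exp.tendsto _).comp hlim).congr' ?_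
  filter_upwards [hfin, hle] with F hF hFr
  refine (finiteRankDet_eq_exp hF ?_).symm
  rw [poincareNorm_eq_toReal]
  exact lt_of_le_of_lt (ENNReal.toReal_le_coe_of_le_coe hFr) hr1'

end Plemelj

section LatticeNorm

variable {n : ℕ}

theorem latticeNorm_eq_norm (k : IntLattice n) :
    latticeNorm k = ‖(WithLp.toLp 2 fun i => (k i : ℝ) : EuclideanSpace ℝ (Fin n))‖ := by
  simp [latticeNorm, EuclideanSpace.norm_eq]

theorem latticeNorm_nonneg (k : IntLattice n) : 0 ≤ latticeNorm k := Real.sqrt_nonneg _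

theorem one_add_latticeNorm_pos (k : IntLattice n) : 0 < 1 + latticeNorm k :=
  add_pos_of_pos_of_nonneg one_pos (latticeNorm_nonneg k)

theorem latticeNorm_add_le (k l : IntLattice n) :
    latticeNorm (k + l) ≤ latticeNorm k + latticeNorm l := by
  simp only [latticeNorm_eq_norm]
  refine le_trans (le_of_eq (congrArg norm ?_)) (norm_add_le _ _)
  ext i
  simp

theorem latticeNorm_neg (k : IntLattice n) : latticeNorm (-k) = latticeNorm k := by
  simp [latticeNorm]

theorem latticeNorm_sq (k : IntLattice n) : latticeNorm k ^ 2 = ∑ i, (k i : ℝ) ^ 2 :=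
  Real.sq_sqrt (Finset.sum_nonneg fun _ _ => sq_nonneg _)

theorem latticeNorm_single (i : Fin n) : latticeNorm (Pi.single i 1 : IntLattice n) = 1 := by
  have h : ∑ j, (((Pi.single i 1 : IntLattice n) j : ℤ) : ℝ) ^ 2 = 1 := by
    rw [Finset.sum_eq_single i] <;> simp +contextual
  rw [latticeNorm, h, Real.sqrt_one]

theorem latticeNorm_le_add_single (k : IntLattice n) (i : Fin n) :
    latticeNorm k ≤ latticeNorm (k + Pi.single i 1) + 1 := by
  have h := latticeNorm_add_le (k + Pi.single i 1) (-Pi.single i 1)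
  rwa [add_neg_cancel_right, latticeNorm_neg, latticeNorm_single] at h

theorem latticeNorm_add_single_le (k : IntLattice n) (i : Fin n) :
    latticeNorm (k + Pi.single i 1) ≤ latticeNorm k + 1 := by
  have h := latticeNorm_add_le k (Pi.single i 1)
  rwa [latticeNorm_single] at h

theorem one_le_latticeNorm_add (k : IntLattice n) (i : Fin n) :
    1 ≤ latticeNorm (k + Pi.single i 1) + latticeNorm k := by
  have h := latticeNorm_add_le (k + Pi.single i 1) (-k)
  rwa [add_neg_cancel_comm, latticeNorm_neg, latticeNorm_single] at h

theorem latticeNorm_add_single_sq_sub (k : IntLattice n) (i : Fin n) :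
    latticeNorm (k + Pi.single i 1) ^ 2 - latticeNorm k ^ 2 = 2 * k i + 1 := by
  rw [latticeNorm_sq, latticeNorm_sq, ← Finset.sum_sub_distrib, Finset.sum_eq_single i]
  · simp
    ring
  · intro j _ hj
    simp [Pi.single_eq_of_ne hj]
  · simp

theorem one_add_latticeNorm_add_single_rpow_le (ν : ℝ) (k : IntLattice n) (i : Fin n) :
    (1 + latticeNorm (k + Pi.single i 1)) ^ ν ≤ 2 ^ |ν| * (1 + latticeNorm k) ^ ν := by
  have h1 := latticeNorm_le_add_single k i
  have h2 := latticeNorm_add_single_le k i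
  have h3 := latticeNorm_nonneg k
  have h4 := latticeNorm_nonneg (k + Pi.single i 1)
  rcases le_total 0 ν with hν | hν
  · rw [abs_of_nonneg hν, ← Real.mul_rpow zero_le_two (by linarith)]
    exact Real.rpow_le_rpow (by linarith) (by linarith) hν
  · rw [abs_of_nonpos hν, Real.rpow_neg zero_le_two, ← Real.inv_rpow zero_le_two,
      ← Real.mul_rpow (by norm_num) (by linarith)]
    exact Real.rpow_le_rpow_of_nonpos (by linarith) (by linarith) hν

end LatticeNorm

section DiscreteSymbols

variable {n : ℕ} {a b : IntLattice n → ℂ} {ν μ : ℝ}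

/-- `a k = O((1 + |k|) ^ ν)`. -/
def HasLatticeOrder (ν : ℝ) (a : IntLattice n → ℂ) : Prop :=
  ∃ C : ℝ, ∀ k, ‖a k‖ ≤ C * (1 + latticeNorm k) ^ ν

/-- The symbols `a` on the lattice with `Δ^α a = O((1 + |k|) ^ (ν - |α|))` for `|α| ≤ m`. -/
def IsLatticeSymbol : ℕ → ℝ → (IntLattice n → ℂ) → Prop
  | 0, ν, a => HasLatticeOrder ν a
  | m + 1, ν, a => HasLatticeOrder ν a ∧
      ∀ i, IsLatticeSymbol m (ν - 1) (fwdDiff (Pi.single i 1 : IntLattice n) a)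

theorem HasLatticeOrder.mono (h : HasLatticeOrder ν a) (hν : ν ≤ μ) : HasLatticeOrder μ a := by
  obtain ⟨C, hC⟩ := h
  refine ⟨|C|, fun k => (hC k).trans ?_⟩
  have := latticeNorm_nonneg k
  exact mul_le_mul (le_abs_self C) (Real.rpow_le_rpow_of_exponent_le (by linarith) hν)
    (by positivity) (abs_nonneg C)

theorem HasLatticeOrder.add (ha : HasLatticeOrder ν a) (hb : HasLatticeOrder ν b) :
    HasLatticeOrder ν (a + b) := by
  obtain ⟨C, hC⟩ := ha
  obtain ⟨D, hD⟩ := hb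
  refine ⟨C + D, fun k => (norm_add_le _ _).trans ?_⟩
  rw [add_mul]
  exact add_le_add (hC k) (hD k)

theorem HasLatticeOrder.mul (ha : HasLatticeOrder ν a) (hb : HasLatticeOrder μ b) :
    HasLatticeOrder (ν + μ) (a * b) := by
  obtain ⟨C, hC⟩ := ha
  obtain ⟨D, hD⟩ := hb
  refine ⟨C * D, fun k => ?_⟩
  rw [Pi.mul_apply, norm_mul, Real.rpow_add (one_add_latticeNorm_pos k), mul_mul_mul_comm]
  exact mul_le_mul (hC k) (hD k) (norm_nonneg _) ((norm_nonneg _).trans (hC k))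

theorem HasLatticeOrder.shift (ha : HasLatticeOrder ν a) (i : Fin n) :
    HasLatticeOrder ν fun k => a (k + Pi.single i 1) := by
  obtain ⟨C, hC⟩ := ha
  refine ⟨|C| * 2 ^ |ν|, fun k => (hC _).trans ?_⟩
  rw [mul_assoc]
  have := latticeNorm_nonneg (k + Pi.single i 1)
  exact mul_le_mul (le_abs_self C) (one_add_latticeNorm_add_single_rpow_le ν k i)
    (by positivity) (abs_nonneg C)

namespace IsLatticeSymbol

variable {m : ℕ}

theorem hasLatticeOrder (h : IsLatticeSymbol m ν a) : HasLatticeOrder ν a := by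
  cases m with
  | zero => exact h
  | succ m => exact h.1

theorem of_succ (h : IsLatticeSymbol (m + 1) ν a) : IsLatticeSymbol m ν a := by
  induction m generalizing ν a with
  | zero => exact h.1
  | succ m ih => exact ⟨h.1, fun i => ih (h.2 i)⟩

theorem add (ha : IsLatticeSymbol m ν a) (hb : IsLatticeSymbol m ν b) :
    IsLatticeSymbol m ν (a + b) := by
  induction m generalizing ν a b with
  | zero => exact HasLatticeOrder.add ha hb
  | succ m ih =>
    refine ⟨ha.1.add hb.1, fun i => ?_⟩
    rw [fwdDiff_add]
    exact ih (ha.2 i) (hb.2 i)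

theorem shift (ha : IsLatticeSymbol m ν a) (i : Fin n) :
    IsLatticeSymbol m ν fun k => a (k + Pi.single i 1) := by
  induction m generalizing ν a with
  | zero => exact HasLatticeOrder.shift ha i
  | succ m ih =>
    refine ⟨ha.1.shift i, fun j => ?_⟩
    convert ih (ha.2 j) using 1
    ext k
    simp only [fwdDiff, add_right_comm]

theorem mul (ha : IsLatticeSymbol m ν a) (hb : IsLatticeSymbol m μ b) :
    IsLatticeSymbol m (ν + μ) (a * b) := by
  induction m generalizing ν μ a b with
  | zero => exact HasLatticeOrder.mul ha hb
  | succ m ih =>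
    refine ⟨ha.1.mul hb.1, fun i => ?_⟩
    have h1 := ih (ha.2 i) hb.of_succ
    have h2 := ih (ha.of_succ.shift i) (hb.2 i)
    rw [show ν - 1 + μ = ν + μ - 1 by ring] at h1
    rw [show ν + (μ - 1) = ν + μ - 1 by ring] at h2
    convert h1.add h2 using 1
    ext k
    simp only [fwdDiff, Pi.add_apply, Pi.mul_apply]
    ring

theorem zero : IsLatticeSymbol m ν (fun _ : IntLattice n => 0) := by
  induction m generalizing ν with
  | zero => exact ⟨0, by simp⟩
  | succ m ih =>
    refine ⟨⟨0, by simp⟩, fun i => ?_⟩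
    rw [fwdDiff_const]
    exact ih

theorem const (c : ℂ) (hν : 0 ≤ ν) : IsLatticeSymbol m ν (fun _ : IntLattice n => c) := by
  have h0 : HasLatticeOrder ν (fun _ : IntLattice n => c) := by
    refine ⟨‖c‖, fun k => le_mul_of_one_le_right (norm_nonneg c) ?_⟩
    exact Real.one_le_rpow (by linarith [latticeNorm_nonneg k]) hν
  cases m with
  | zero => exact h0
  | succ m =>
    refine ⟨h0, fun i => ?_⟩
    rw [fwdDiff_const]
    exact zero

theorem inv (ha : IsLatticeSymbol m 1 a) {c : ℝ} (hc : 0 < c)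
    (h : ∀ k, c * (1 + latticeNorm k) ≤ ‖a k‖) : IsLatticeSymbol m (-1) a⁻¹ := by
  have h0 : HasLatticeOrder (-1) a⁻¹ := by
    refine ⟨c⁻¹, fun k => ?_⟩
    have := one_add_latticeNorm_pos k
    rw [Pi.inv_apply, norm_inv, Real.rpow_neg_one, ← mul_inv]
    exact inv_anti₀ (by positivity) (h k)
  have hne : ∀ k, a k ≠ 0 := fun k => by
    have := one_add_latticeNorm_pos k
    exact norm_pos_iff.1 (lt_of_lt_of_le (by positivity) (h k))
  induction m with
  | zero => exact h0
  | succ m ih =>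
    refine ⟨h0, fun i => ?_⟩
    have hinv := ih ha.of_succ
    have h1 := ((const (m := m) (-1) le_rfl).mul (ha.2 i)).mul (hinv.mul (hinv.shift i))
    convert h1 using 1
    · norm_num
    · ext k
      have h2 := hne k
      have h3 := hne (k + Pi.single i 1)
      simp only [fwdDiff, Pi.inv_apply, Pi.mul_apply]
      field_simp
      ring

theorem pow (ha : IsLatticeSymbol m ν a) (p : ℕ) : IsLatticeSymbol m (p * ν) (a ^ p) := by
  induction p with
  | zero =>
    rw [pow_zero, Nat.cast_zero, zero_mul]
    exact const 1 le_rfl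
  | succ p ih =>
    rw [pow_succ, Nat.cast_succ, add_one_mul]
    exact ih.mul ha

end IsLatticeSymbol

theorem isLatticeSymbol_coord (m : ℕ) (i : Fin n) :
    IsLatticeSymbol m 1 (fun k : IntLattice n => (2 * k i + 1 : ℂ)) := by
  have h0 : HasLatticeOrder 1 (fun k : IntLattice n => (2 * k i + 1 : ℂ)) := by
    refine ⟨2, fun k => ?_⟩
    have h1 : |(k i : ℝ)| ≤ latticeNorm k := by
      refine Real.abs_le_sqrt ?_
      exact Finset.single_le_sum (f := fun j => (k j : ℝ) ^ 2) (fun _ _ => sq_nonneg _)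
        (Finset.mem_univ i)
    have h2 : ‖(2 * k i + 1 : ℂ)‖ ≤ 2 * |(k i : ℝ)| + 1 := by
      refine (norm_add_le _ _).trans ?_
      rw [norm_mul, Complex.norm_intCast]
      simp
    rw [Real.rpow_one]
    linarith
  cases m with
  | zero => exact h0
  | succ m =>
    refine ⟨h0, fun j => ?_⟩
    have h1 := IsLatticeSymbol.const (n := n) (m := m)
      (2 * ((Pi.single j 1 : IntLattice n) i : ℂ)) (le_refl (0 : ℝ))
    convert h1 using 1
    · norm_num
    · ext k
      simp only [fwdDiff, Pi.add_apply]
      push_cast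
      ring

theorem isLatticeSymbol_latticeNorm (m : ℕ) :
    IsLatticeSymbol m 1 (fun k : IntLattice n => (latticeNorm k : ℂ)) := by
  have h0 : HasLatticeOrder 1 (fun k : IntLattice n => (latticeNorm k : ℂ)) := by
    refine ⟨1, fun k => ?_⟩
    rw [Complex.norm_real, Real.norm_of_nonneg (latticeNorm_nonneg k), Real.rpow_one]
    linarith
  induction m with
  | zero => exact h0
  | succ m ih =>
    refine ⟨h0, fun i => ?_⟩
    have hsum := (ih.shift i).add ih
    have hnorm : ∀ k : IntLattice n, ‖(latticeNorm (k + Pi.single i 1) : ℂ) + latticeNorm k‖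
        = latticeNorm (k + Pi.single i 1) + latticeNorm k := fun k => by
      rw [← Complex.ofReal_add, Complex.norm_real]
      exact Real.norm_of_nonneg (add_nonneg (latticeNorm_nonneg _) (latticeNorm_nonneg _))
    have hinv := hsum.inv (c := 1 / 2) (by norm_num) fun k => by
      rw [Pi.add_apply, hnorm k]
      linarith [one_le_latticeNorm_add k i, latticeNorm_nonneg (k + Pi.single i 1)]
    convert (isLatticeSymbol_coord m i).mul hinv using 1
    · norm_num
    · ext k
      have hne : (latticeNorm (k + Pi.single i 1) : ℂ) + latticeNorm k ≠ 0 := by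
        rw [← norm_pos_iff, hnorm k]
        linarith [one_le_latticeNorm_add k i]
      simp only [fwdDiff, Pi.mul_apply, Pi.inv_apply, Pi.add_apply]
      rw [eq_mul_inv_iff_mul_eq₀ hne]
      have h := congrArg (Complex.ofReal) (latticeNorm_add_single_sq_sub k i)
      push_cast at h
      rw [← h]
      ring

theorem isLatticeSymbol_borderline (m : ℕ) (x : Torus n) :
    IsLatticeSymbol m (-(n : ℝ)) (borderlineSymbol n x) := by
  have h1 : IsLatticeSymbol m 1 (fun k : IntLattice n => (1 + latticeNorm k : ℂ)) :=
    (IsLatticeSymbol.const 1 zero_le_one).add (isLatticeSymbol_latticeNorm m)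
  have h2 := (h1.inv one_pos fun k => by
    rw [one_mul, ← Complex.ofReal_one, ← Complex.ofReal_add, Complex.norm_real]
    exact le_abs_self _).pow n
  convert h2 using 1
  · ring
  · ext k
    rw [borderlineSymbol, Real.rpow_neg (one_add_latticeNorm_pos k).le, Real.rpow_natCast]
    simp

theorem IsLatticeSymbol.iterate_fwdDiff (h : ∀ m, IsLatticeSymbol m ν a) (i : Fin n) (p m : ℕ) :
    IsLatticeSymbol m (ν - p) ((fwdDiff (Pi.single i 1 : IntLattice n))^[p] a) := by
  induction p generalizing m with
  | zero => simpa using h m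
  | succ p ih =>
    rw [Function.iterate_succ_apply', Nat.cast_succ, ← sub_sub]
    exact (ih (m + 1)).2 i

theorem IsLatticeSymbol.multiDiff (h : ∀ m, IsLatticeSymbol m ν a) (α : Fin n → ℕ) (m : ℕ) :
    IsLatticeSymbol m (ν - ∑ i, (α i : ℝ)) (multiDiff α a) := by
  rw [Fin.sum_univ_def, _root_.multiDiff]
  generalize List.finRange n = l
  induction l generalizing m with
  | nil => simpa using h m
  | cons i l ih =>
    rw [List.map_cons, List.sum_cons, List.foldr_cons, add_comm, ← sub_sub]
    exact IsLatticeSymbol.iterate_fwdDiff ih i (α i) m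

theorem exists_multiDeriv_const (β : Fin n → ℕ) :
    ∃ δ : ℂ, ∀ c, multiDeriv β (fun _ => c) = fun _ => δ * c := by
  have hp : ∀ (i : Fin n) (p : ℕ), ∃ δ : ℂ, ∀ c : ℂ,
      (partialDeriv i)^[p] (fun _ => c) = fun _ => δ * c := by
    intro i p
    cases p with
    | zero => exact ⟨1, by simp⟩
    | succ p =>
      refine ⟨0, fun c => ?_⟩
      have h : ∀ c : ℂ, partialDeriv i (fun _ => c) = fun _ => 0 := fun c => by
        ext x
        simp [partialDeriv, lineDeriv]
      induction p with
      | zero => simp [h]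
      | succ p ih => rw [Function.iterate_succ_apply', ih, h, zero_mul]
  rw [show multiDeriv β = fun g : (Fin n → ℝ) → ℂ =>
    (List.finRange n).foldr (fun i h => (partialDeriv i)^[β i] h) g from rfl]
  generalize List.finRange n = l
  induction l with
  | nil => exact ⟨1, by simp⟩
  | cons i l ih =>
    obtain ⟨δ, hδ⟩ := ih
    obtain ⟨ε, hε⟩ := hp i (β i)
    refine ⟨ε * δ, fun c => ?_⟩
    have h := hδ c
    simp only [List.foldr_cons] at h ⊢
    rw [h, hε, mul_assoc]

theorem isToroidalSymbol_borderline {ν : ℝ} (hν : -(n : ℝ) ≤ ν) :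
    IsToroidalSymbol ν (borderlineSymbol n) where
  smooth k := contDiff_const
  bound α β := by
    obtain ⟨δ, hδ⟩ := exists_multiDeriv_const (n := n) β
    have h1 : ∀ m, IsLatticeSymbol m (-(n : ℝ)) (fun k => δ * borderlineSymbol n 0 k) := fun m => by
      have := (IsLatticeSymbol.const (m := m) δ le_rfl).mul (isLatticeSymbol_borderline (n := n) m 0)
      rwa [zero_add] at this
    obtain ⟨C, hC⟩ := (IsLatticeSymbol.multiDiff h1 α 0).hasLatticeOrder.mono
      (sub_le_sub_right hν _)
    refine ⟨C, fun x k => le_trans (le_of_eq ?_) (hC k)⟩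
    congr 2
    ext l
    exact congrFun (hδ (borderlineSymbol n 0 l)) x

end DiscreteSymbols

section LatticeSums

variable {n : ℕ}

theorem summable_one_add_norm_rpow {r : ℝ} (hr : r < -(n : ℝ)) :
    Summable fun k : IntLattice n => (1 + ‖k‖) ^ r := by
  let L := Submodule.span ℤ (Set.range (Pi.basisFun ℝ (Fin n)))
  have hrank : Module.finrank ℤ L = n := by
    rw [ZLattice.rank ℝ L, Module.finrank_fin_fun]
  let φ : IntLattice n → L := fun k => ⟨fun i => (k i : ℝ), by
    refine ((Pi.basisFun ℝ (Fin n)).mem_span_iff_repr_mem ℤ _).2 ?_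
    exact fun i => ⟨k i, by simp⟩⟩
  have hφ : Function.Injective φ := fun k l h => by
    ext i
    exact Int.cast_injective (α := ℝ) (congrFun (congrArg Subtype.val h) i)
  have hs : Summable fun k : IntLattice n => ‖k‖ ^ r := by
    have h := (ZLattice.summable_norm_rpow L r (by rwa [hrank])).comp_injective hφ
    refine h.congr fun k => ?_
    have : ‖φ k‖ = ‖k‖ := by
      change ‖fun i => (k i : ℝ)‖ = ‖k‖
      simp [Pi.norm_def, nnnorm, Int.norm_eq_abs]
    exact congrArg (· ^ r) this.symm
  refine Summable.of_norm_bounded_eventually hs ?_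
  filter_upwards [(Set.finite_singleton (0 : IntLattice n)).compl_mem_cofinite] with k hk
  have hk0 : 0 < ‖k‖ := norm_pos_iff.2 hk
  rw [Real.norm_of_nonneg (by positivity)]
  exact Real.rpow_le_rpow_of_nonpos hk0 (by linarith)
    (hr.le.trans (neg_nonpos.2 (Nat.cast_nonneg n)))

theorem norm_le_latticeNorm (k : IntLattice n) : ‖k‖ ≤ latticeNorm k := by
  refine (pi_norm_le_iff_of_nonneg (latticeNorm_nonneg k)).2 fun i => ?_
  rw [Int.norm_eq_abs]
  refine Real.abs_le_sqrt ?_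
  exact Finset.single_le_sum (f := fun j => (k j : ℝ) ^ 2) (fun _ _ => sq_nonneg _)
    (Finset.mem_univ i)

theorem summable_one_add_latticeNorm_rpow {r : ℝ} (hr : r < -(n : ℝ)) :
    Summable fun k : IntLattice n => (1 + latticeNorm k) ^ r := by
  refine (summable_one_add_norm_rpow hr).of_nonneg_of_le
    (fun k => Real.rpow_nonneg (one_add_latticeNorm_pos k).le r) fun k => ?_
  exact Real.rpow_le_rpow_of_nonpos (by positivity) (by linarith [norm_le_latticeNorm k])
    (hr.le.trans (neg_nonpos.2 (Nat.cast_nonneg n)))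

theorem latticeNorm_le_of_abs_le {k : IntLattice n} {R : ℝ} (hR : 0 ≤ R)
    (h : ∀ i, |(k i : ℝ)| ≤ R) : latticeNorm k ≤ n * R := by
  have h1 : ∑ i, (k i : ℝ) ^ 2 ≤ n * R ^ 2 := by
    calc ∑ i, (k i : ℝ) ^ 2 ≤ ∑ _i : Fin n, R ^ 2 :=
          Finset.sum_le_sum fun i _ => sq_le_sq' (abs_le.1 (h i)).1 (abs_le.1 (h i)).2
      _ = n * R ^ 2 := by simp
  refine Real.sqrt_le_iff.2 ⟨by positivity, h1.trans ?_⟩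
  rw [mul_pow]
  have h2 : (n : ℝ) ≤ (n : ℝ) ^ 2 := by exact_mod_cast Nat.le_self_pow two_ne_zero n
  gcongr

/-- The sum of `(1 + |k|) ^ (-n)` over `ℤⁿ` diverges, since its parts over the boxes `[N, 2N)ⁿ`
are bounded below. -/
theorem not_summable_one_add_latticeNorm_rpow (hn : 1 ≤ n) :
    ¬ Summable fun k : IntLattice n => (1 + latticeNorm k) ^ (-(n : ℝ)) := by
  intro hs
  let c : ℝ := ((1 + 2 * n : ℝ) ^ n)⁻¹
  have hc : 0 < c := by positivity
  obtain ⟨s, hs⟩ := summable_iff_vanishing_norm.1 hs c hc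
  obtain ⟨N, hN⟩ : ∃ N : ℕ, 1 ≤ N ∧ ∀ k ∈ s, ∀ i, k i < N := by
    refine ⟨(s.sup fun k => Finset.univ.sup fun i => (k i).natAbs) + 1, by omega,
      fun k hk i => ?_⟩
    have h1 : (k i).natAbs ≤ Finset.univ.sup fun i => (k i).natAbs :=
      Finset.le_sup (f := fun i => (k i).natAbs) (Finset.mem_univ i)
    have h2 : (Finset.univ.sup fun i => (k i).natAbs)
        ≤ s.sup fun k => Finset.univ.sup fun i => (k i).natAbs :=
      Finset.le_sup (f := fun k : IntLattice n => Finset.univ.sup fun i => (k i).natAbs) hk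
    omega
  let t : Finset (IntLattice n) := Fintype.piFinset fun _ => Finset.Ico (N : ℤ) (2 * N)
  have hN0 : (1 : ℝ) ≤ N := by exact_mod_cast hN.1
  have hdisj : Disjoint t s := by
    refine Finset.disjoint_left.2 fun k hk hks => ?_
    have h1 := Finset.mem_Ico.1 (Fintype.mem_piFinset.1 hk ⟨0, hn⟩)
    exact absurd (hN.2 k hks ⟨0, hn⟩) (not_lt.2 h1.1)
  have hcard : (t.card : ℝ) = (N : ℝ) ^ n := by
    rw [Fintype.card_piFinset_const, Int.card_Ico, Nat.cast_pow]
    congr 2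
    omega
  have hterm : ∀ k ∈ t, ((1 + 2 * n : ℝ) * N) ^ (-(n : ℝ)) ≤ (1 + latticeNorm k) ^ (-(n : ℝ)) := by
    intro k hk
    have h1 : latticeNorm k ≤ n * (2 * N) := by
      refine latticeNorm_le_of_abs_le (by positivity) fun i => ?_
      have h2 := Finset.mem_Ico.1 (Fintype.mem_piFinset.1 hk i)
      have h3 : ((N : ℤ) : ℝ) ≤ k i := by exact_mod_cast h2.1
      have h4 : (k i : ℝ) ≤ ((2 * N : ℤ) : ℝ) := by exact_mod_cast h2.2.le
      push_cast at h3 h4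
      rw [abs_of_nonneg (by linarith)]
      exact h4
    refine Real.rpow_le_rpow_of_nonpos (one_add_latticeNorm_pos k) ?_
      (neg_nonpos.2 (Nat.cast_nonneg n))
    nlinarith
  have hsum : c ≤ ∑ k ∈ t, (1 + latticeNorm k) ^ (-(n : ℝ)) := by
    refine le_trans (le_of_eq ?_) (Finset.card_nsmul_le_sum t _ _ hterm)
    rw [nsmul_eq_mul, hcard, Real.rpow_neg (by positivity), Real.rpow_natCast, mul_pow]
    simp only [c]
    field_simp
  exact absurd (hs t hdisj) (not_lt.2 (hsum.trans (le_abs_self _)))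

end LatticeSums

section FourierDecay

variable {n : ℕ} {G : (Fin n → ℝ) → ℂ}

theorem partialDeriv_eq_fderiv (hG : ContDiff ℝ ∞ G) (i : Fin n) :
    partialDeriv i G = fun x => fderiv ℝ G x (Pi.single i 1) :=
  funext fun x => (hG.differentiable (by simp) x).lineDeriv_eq_fderiv

theorem ContDiff.partialDeriv (hG : ContDiff ℝ ∞ G) (i : Fin n) :
    ContDiff ℝ ∞ (partialDeriv i G) := by
  rw [partialDeriv_eq_fderiv hG]
  exact (hG.fderiv_right (m := ∞) (by simp)).clm_apply contDiff_const

theorem ContDiff.iterate_partialDeriv (hG : ContDiff ℝ ∞ G) (i : Fin n) (N : ℕ) :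
    ContDiff ℝ ∞ ((_root_.partialDeriv i)^[N] G) := by
  induction N with
  | zero => exact hG
  | succ N ih =>
    rw [Function.iterate_succ_apply']
    exact ih.partialDeriv i

theorem ContDiff.fwdDiff (hG : ContDiff ℝ ∞ G) (v : Fin n → ℝ) :
    ContDiff ℝ ∞ (fwdDiff v G) :=
  (hG.comp (contDiff_id.add contDiff_const)).sub hG

theorem partialDeriv_fwdDiff (hG : ContDiff ℝ ∞ G) (i : Fin n) (v : Fin n → ℝ) :
    partialDeriv i (fwdDiff v G) = fwdDiff v (partialDeriv i G) := by
  rw [partialDeriv_eq_fderiv (hG.fwdDiff v), partialDeriv_eq_fderiv hG]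
  have hd := hG.differentiable (by simp)
  ext x
  have h : fderiv ℝ (fwdDiff v G) x = fderiv ℝ G (x + v) - fderiv ℝ G x := by
    rw [← fderiv_comp_add_right v]
    exact fderiv_sub ((hd (x + v)).comp x (differentiableAt_id.add_const v)) (hd x)
  rw [h]
  rfl

theorem iterate_partialDeriv_fwdDiff (hG : ContDiff ℝ ∞ G) (i : Fin n) (v : Fin n → ℝ) (N : ℕ) :
    (partialDeriv i)^[N] (fwdDiff v G) = fwdDiff v ((partialDeriv i)^[N] G) := by
  induction N with
  | zero => rfl
  | succ N ih =>
    rw [Function.iterate_succ_apply', ih, partialDeriv_fwdDiff (hG.iterate_partialDeriv i N),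
      Function.iterate_succ_apply']

theorem norm_fwdDiff_single_le (hG : ContDiff ℝ ∞ G) (i : Fin n) {M : ℝ}
    (hM : ∀ x, ‖partialDeriv i G x‖ ≤ M) (h : ℝ) (x : Fin n → ℝ) :
    ‖fwdDiff (Pi.single i h : Fin n → ℝ) G x‖ ≤ |h| * M := by
  have hd := hG.differentiable (by simp)
  have hder : ∀ t : ℝ, HasDerivAt (fun t : ℝ => G (x + t • (Pi.single i 1 : Fin n → ℝ)))
      (partialDeriv i G (x + t • (Pi.single i 1 : Fin n → ℝ))) t := fun t => by
    rw [partialDeriv_eq_fderiv hG]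
    have h1 : HasDerivAt (fun t : ℝ => x + t • (Pi.single i 1 : Fin n → ℝ))
        (Pi.single i 1) t := by
      simpa using ((hasDerivAt_id t).smul_const (Pi.single i 1 : Fin n → ℝ)).const_add x
    exact (hd _).hasFDerivAt.comp_hasDerivAt t h1
  have h2 := convex_univ.norm_image_sub_le_of_norm_hasDerivWithin_le (C := M)
    (fun t _ => (hder t).hasDerivWithinAt) (fun t _ => hM _) (Set.mem_univ 0) (Set.mem_univ h)
  rw [zero_smul, add_zero, sub_zero, ← Pi.single_smul, smul_eq_mul, mul_one, Real.norm_eq_abs,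
    mul_comm] at h2
  exact h2

theorem isOpenQuotientMap_torus :
    IsOpenQuotientMap fun (x : Fin n → ℝ) (i : Fin n) => (x i : UnitAddCircle) :=
  IsOpenQuotientMap.piMap fun _ => QuotientAddGroup.isOpenQuotientMap_mk

theorem IsTorusSmooth.continuous {f : Torus n → ℂ} (hf : IsTorusSmooth f) : Continuous f :=
  isOpenQuotientMap_torus.isQuotientMap.continuous_iff.2 (ContDiff.continuous hf)

theorem mFourier_add_apply (l : IntLattice n) (x t : Torus n) :
    mFourier l (x + t) = mFourier l x * mFourier l t := by
  simp [mFourier, fourier_apply, smul_add, AddCircle.toCircle_add, Finset.prod_mul_distrib]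

/-- The point `h e_i` of the torus. -/
noncomputable def torusSingle (i : Fin n) (h : ℝ) : Torus n :=
  fun j => ((Pi.single i h : Fin n → ℝ) j : UnitAddCircle)

theorem mFourier_neg_torusSingle (l : IntLattice n) (i : Fin n) (hl : l i ≠ 0) :
    mFourier (-l) (torusSingle i (1 / (2 * l i))) = -1 := by
  have hl' : (l i : ℂ) ≠ 0 := by exact_mod_cast hl
  change ∏ j, fourier ((-l) j) (torusSingle i (1 / (2 * l i)) j) = -1
  rw [Finset.prod_eq_single i]
  · rw [torusSingle, Pi.single_eq_same, fourier_coe_apply, ← Complex.exp_neg_pi_mul_I]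
    congr 1
    push_cast [Pi.neg_apply]
    field_simp
  · intro j _ hj
    rw [torusSingle, Pi.single_eq_of_ne hj]
    simp
  · simp

theorem mFourierCoeff_fwdDiff {f : Torus n → ℂ} (hf : Continuous f) (l : IntLattice n) (i : Fin n)
    (hl : l i ≠ 0) :
    mFourierCoeff (fwdDiff (torusSingle i (1 / (2 * l i))) f) l = -2 * mFourierCoeff f l := by
  set t := torusSingle i (1 / (2 * l i)) with ht
  have hint : ∀ g : Torus n → ℂ, Continuous g → Integrable g (volume : Measure (Torus n)) :=
    fun g hg => hg.integrable_of_hasCompactSupport (HasCompactSupport.of_compactSpace g)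
  have hshift : ∫ x : Torus n, mFourier (-l) x * f (x + t) = -∫ x : Torus n, mFourier (-l) x * f x := by
    rw [← integral_add_right_eq_self (fun x : Torus n => mFourier (-l) x * f x) t, ← integral_neg]
    refine integral_congr_ae (Eventually.of_forall fun x => ?_)
    simp only [mFourier_add_apply, ht, mFourier_neg_torusSingle l i hl]
    ring
  have h : mFourierCoeff (fwdDiff t f) l
      = ∫ x : Torus n, (mFourier (-l) x * f (x + t) - mFourier (-l) x * f x) :=
    integral_congr_ae (Eventually.of_forall fun x => by simp [fwdDiff, mul_sub])
  rw [h, integral_sub, hshift]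
  · change -mFourierCoeff f l - mFourierCoeff f l = _
    ring
  · exact hint _ (by fun_prop)
  · exact hint _ (by fun_prop)

theorem norm_mFourierCoeff_le {f : Torus n → ℂ} {M : ℝ} (hM : ∀ x, ‖f x‖ ≤ M) (l : IntLattice n) :
    ‖mFourierCoeff f l‖ ≤ M := by
  have h := norm_integral_le_of_norm_le_const (μ := (volume : Measure (Torus n))) (C := M)
    (f := fun x => mFourier (-l) x • f x) (Eventually.of_forall fun x => by
      rw [norm_smul]
      refine (mul_le_of_le_one_left (norm_nonneg _) ?_).trans (hM x)
      exact ((mFourier (-l)).norm_coe_le_norm x).trans mFourier_norm.le)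
  rw [probReal_univ, mul_one] at h
  exact h

theorem torusLift_fwdDiff (f : Torus n → ℂ) (i : Fin n) (h : ℝ) :
    torusLift (fwdDiff (torusSingle i h) f) = fwdDiff (Pi.single i h : Fin n → ℝ) (torusLift f) := by
  ext x
  simp only [torusLift, fwdDiff]
  congr 2

theorem two_pow_mul_norm_mFourierCoeff_le {f : Torus n → ℂ} (hf : IsTorusSmooth f)
    (l : IntLattice n) (i : Fin n) (hl : l i ≠ 0) {N : ℕ} {M : ℝ}
    (hM : ∀ x, ‖(partialDeriv i)^[N] (torusLift f) x‖ ≤ M) :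
    2 ^ N * ‖mFourierCoeff f l‖ ≤ |1 / (2 * l i : ℝ)| ^ N * M := by
  induction N generalizing f M with
  | zero =>
    rw [pow_zero, one_mul, pow_zero, one_mul]
    refine norm_mFourierCoeff_le (fun x => ?_) l
    obtain ⟨y, rfl⟩ := isOpenQuotientMap_torus.surjective x
    exact hM y
  | succ N ih =>
    have hsm : IsTorusSmooth (fwdDiff (torusSingle i (1 / (2 * l i))) f) := by
      rw [IsTorusSmooth, torusLift_fwdDiff]
      exact ContDiff.fwdDiff hf _
    have h := ih hsm (M := |1 / (2 * l i : ℝ)| * M) fun x => by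
      rw [torusLift_fwdDiff, iterate_partialDeriv_fwdDiff hf]
      refine norm_fwdDiff_single_le (ContDiff.iterate_partialDeriv hf i N) i (fun y => ?_) _ x
      have := hM y
      rwa [Function.iterate_succ_apply'] at this
    rw [mFourierCoeff_fwdDiff hf.continuous l i hl, norm_mul, norm_neg, Complex.norm_two] at h
    rw [pow_succ, pow_succ, mul_assoc, mul_assoc]
    exact h

/-- The decay of the Fourier coefficients of a smooth function on the torus. -/
theorem norm_mFourierCoeff_le_of_partialDeriv {f : Torus n → ℂ} (hf : IsTorusSmooth f) {N : ℕ}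
    {M : ℝ} (hM0 : ∀ x, ‖f x‖ ≤ M)
    (hM : ∀ i x, ‖(partialDeriv i)^[N] (torusLift f) x‖ ≤ M) (l : IntLattice n) :
    ‖mFourierCoeff f l‖ ≤ 2 ^ N * M * (1 + ‖l‖) ^ (-(N : ℝ)) := by
  have hMnn : 0 ≤ M := (norm_nonneg _).trans (hM0 0)
  rw [Real.rpow_neg (by positivity), Real.rpow_natCast, ← div_eq_mul_inv,
    le_div_iff₀ (by positivity)]
  by_cases hl : l = 0
  · rw [hl, norm_zero, add_zero, one_pow, mul_one]
    exact (norm_mFourierCoeff_le hM0 0).trans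
      (le_mul_of_one_le_left hMnn (one_le_pow₀ one_le_two))
  have hl1 : 0 < ‖l‖ := norm_pos_iff.2 hl
  have : Nonempty (Fin n) := by
    by_contra h
    rw [not_nonempty_iff] at h
    exact hl (Subsingleton.elim _ _)
  obtain ⟨i, hi⟩ : ∃ i, |(l i : ℝ)| = ‖l‖ := by
    obtain ⟨i, -, hi⟩ := Finset.exists_mem_eq_sup Finset.univ Finset.univ_nonempty fun i => ‖l i‖₊
    refine ⟨i, ?_⟩
    rw [Pi.norm_def, hi, coe_nnnorm, Int.norm_eq_abs]
  have hli : l i ≠ 0 := by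
    intro h
    rw [h] at hi
    simp [hl1.ne] at hi
  have h1 : 1 ≤ ‖l‖ := by
    rw [← hi]
    exact_mod_cast Int.one_le_abs hli
  have h2 := two_pow_mul_norm_mFourierCoeff_le hf l i hli (hM i)
  rw [abs_div, abs_mul, abs_one, abs_two, hi, div_pow, one_pow, mul_pow, one_div, inv_mul_eq_div,
    le_div_iff₀ (by positivity)] at h2
  calc ‖mFourierCoeff f l‖ * (1 + ‖l‖) ^ N
      ≤ ‖mFourierCoeff f l‖ * (2 * ‖l‖) ^ N := by
        gcongr
        linarith
    _ = ‖mFourierCoeff f l‖ * (2 ^ N * ‖l‖ ^ N) := by rw [mul_pow]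
    _ ≤ 2 ^ N * ‖mFourierCoeff f l‖ * (2 ^ N * ‖l‖ ^ N) := by
        gcongr
        exact le_mul_of_one_le_left (norm_nonneg _) (one_le_pow₀ one_le_two)
    _ ≤ M := h2
    _ ≤ 2 ^ N * M := le_mul_of_one_le_left hMnn (one_le_pow₀ one_le_two)

end FourierDecay

section Quantisation

variable {n : ℕ} {σ : Torus n → IntLattice n → ℂ}

theorem mFourierCoeff_mFourier_mul (s : Torus n → ℂ) (j k : IntLattice n) :
    mFourierCoeff (fun x => mFourier k x * s x) j = mFourierCoeff s (j - k) := by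
  refine integral_congr_ae (Eventually.of_forall fun x => ?_)
  simp only [smul_eq_mul]
  rw [← mul_assoc, ← mFourier_add, neg_sub, neg_add_eq_sub]

theorem mFourierCoeff_const_mul (c : ℂ) (s : Torus n → ℂ) (l : IntLattice n) :
    mFourierCoeff (fun x => c * s x) l = c * mFourierCoeff s l := by
  rw [mFourierCoeff, mFourierCoeff, ← integral_const_mul]
  simp only [smul_eq_mul, mul_left_comm]

theorem repr_toLp_apply (f : C(Torus n, ℂ)) (j : IntLattice n) :
    (mFourierBasis (d := Fin n)).repr (ContinuousMap.toLp 2 volume ℂ f) j = mFourierCoeff f j :=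
  (mFourierBasis_repr _ j).trans (mFourierCoeff_toLp f j)

theorem repr_fourierConj (A : LatticeL2 n →L[ℂ] LatticeL2 n) (f : TorusL2 n) :
    (mFourierBasis (d := Fin n)).repr (fourierConj A f) = A ((mFourierBasis (d := Fin n)).repr f) :=
  (mFourierBasis (d := Fin n)).repr.apply_symm_apply _

theorem fourierConj_injective : Function.Injective (fourierConj (n := n)) := by
  intro A B h
  ext1 φ
  have h1 := repr_fourierConj A ((mFourierBasis (d := Fin n)).repr.symm φ)
  have h2 := repr_fourierConj B ((mFourierBasis (d := Fin n)).repr.symm φ)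
  rw [h, h2] at h1
  simpa using h1.symm

theorem fourierConj_smul (z : ℂ) (A : LatticeL2 n →L[ℂ] LatticeL2 n) :
    fourierConj (z • A) = z • fourierConj A := by
  ext1 f
  apply (mFourierBasis (d := Fin n)).repr.injective
  rw [repr_fourierConj, smul_apply, smul_apply, map_smul, repr_fourierConj]

/-- The operator with matrix `σ̂(j - k, k)` extends the quantisation of `σ`, provided that
`∑_k sup_x |σ(x, k)| |f̂(k)| < ∞`. -/
theorem extendsQuantisation_fourierConj (hσ : ∀ k, Continuous fun x => σ x k)
    {A : LatticeL2 n →L[ℂ] LatticeL2 n}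
    (hA : ∀ j k, matrixEntry A j k = symbolCoeff σ (j - k) k) {u : IntLattice n → ℝ}
    (hu : ∀ x k, ‖σ x k‖ ≤ u k)
    (hsum : ∀ f : C(Torus n, ℂ), Summable fun k => u k * ‖mFourierCoeff f k‖) :
    ExtendsQuantisation σ (fourierConj A) := by
  intro f _
  let g : IntLattice n → C(Torus n, ℂ) := fun k =>
    mFourierCoeff f k • (mFourier k * ⟨fun x => σ x k, hσ k⟩)
  have hg : Summable g := by
    refine Summable.of_norm_bounded (hsum f) fun k => ?_
    rw [norm_smul, mul_comm]
    refine mul_le_mul_of_nonneg_right ?_ (norm_nonneg _)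
    refine (norm_mul_le _ _).trans ?_
    rw [mFourier_norm, one_mul]
    exact (ContinuousMap.norm_le _ ((norm_nonneg _).trans (hu 0 k))).2 fun x => hu x k
  have hpt : ∀ x, HasSum (fun k => mFourier k x * σ x k * mFourierCoeff f k) ((∑' k, g k) x) := by
    intro x
    refine (ContinuousMap.hasSum_apply hg.hasSum x).congr_fun fun k => ?_
    exact mul_comm _ _
  have hT : fourierConj A (ContinuousMap.toLp 2 volume ℂ f)
      = ContinuousMap.toLp 2 volume ℂ (∑' k, g k) := by
    apply (mFourierBasis (d := Fin n)).repr.injective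
    ext j
    rw [repr_fourierConj]
    have h1 := hasSum_matrixEntry_mul A
      ((mFourierBasis (d := Fin n)).repr (ContinuousMap.toLp 2 volume ℂ f)) j
    have h2 := ((hg.hasSum.mapL (ContinuousMap.toLp 2 (volume : Measure (Torus n)) ℂ)).mapL
      (mFourierBasis (d := Fin n)).repr.toContinuousLinearEquiv.toContinuousLinearMap).mapL
        (lp.evalCLM ℂ (fun _ : IntLattice n => ℂ) 2 j)
    refine h1.unique (h2.congr_fun fun k => ?_)
    rw [hA, repr_toLp_apply]
    have h3 : mFourierCoeff (g k) j = mFourierCoeff f k * symbolCoeff σ (j - k) k := by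
      rw [symbolCoeff, ← mFourierCoeff_mFourier_mul (fun x => σ x k) j k, ← mFourierCoeff_const_mul]
      rfl
    rw [mul_comm, ← h3]
    exact (repr_toLp_apply (g k) j).symm
  rw [hT]
  filter_upwards [ContinuousMap.coeFn_toLp (p := 2) (𝕜 := ℂ) (volume : Measure (Torus n))
    (∑' k, g k)] with x hx
  rw [hx]
  exact hpt x

theorem isTorusSmooth_mFourier (k : IntLattice n) : IsTorusSmooth (mFourier k) := by
  have h : torusLift (mFourier k)
      = fun x : Fin n → ℝ => ∏ i, Complex.exp (2 * Real.pi * Complex.I * k i * x i) := by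
    ext x
    simp [torusLift, mFourier]
  rw [IsTorusSmooth, h]
  refine contDiff_prod fun i _ => ContDiff.cexp (contDiff_const.mul ?_)
  exact Complex.ofRealCLM.contDiff.comp (contDiff_apply ℝ ℝ i)

theorem ExtendsQuantisation.unique {S T : TorusL2 n →L[ℂ] TorusL2 n}
    (hS : ExtendsQuantisation σ S) (hT : ExtendsQuantisation σ T) : S = T := by
  refine ContinuousLinearMap.ext_on (s := Set.range fun k => mFourierLp (d := Fin n) 2 k)
    (Submodule.dense_iff_topologicalClosure_eq_top.2
      (span_mFourierLp_closure_eq_top (by norm_num))) ?_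
  rintro _ ⟨k, rfl⟩
  refine Lp.ext ?_
  filter_upwards [hS (mFourier k) (isTorusSmooth_mFourier k),
    hT (mFourier k) (isTorusSmooth_mFourier k)] with x h1 h2
  exact h1.unique h2

theorem multiDiff_zero (a : IntLattice n → ℂ) : multiDiff 0 a = a := by
  rw [multiDiff]
  induction List.finRange n with
  | nil => rfl
  | cons i l ih => rw [List.foldr_cons, ih]; rfl

theorem multiDeriv_zero (g : (Fin n → ℝ) → ℂ) : multiDeriv 0 g = g := by
  rw [multiDeriv]
  induction List.finRange n with
  | nil => rfl
  | cons i l ih => rw [List.foldr_cons, ih]; rfl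

theorem multiDeriv_single (i : Fin n) (N : ℕ) (g : (Fin n → ℝ) → ℂ) :
    multiDeriv (Pi.single i N) g = (partialDeriv i)^[N] g := by
  have h : ∀ l : List (Fin n), l.Nodup →
      l.foldr (fun j h => (partialDeriv j)^[(Pi.single i N : Fin n → ℕ) j] h) g
        = if i ∈ l then (partialDeriv i)^[N] g else g := by
    intro l hl
    induction l with
    | nil => simp
    | cons j l ih =>
      rw [List.nodup_cons] at hl
      rw [List.foldr_cons, ih hl.2]
      by_cases hj : i = j
      · subst hj
        simp [hl.1]
      · rw [Pi.single_eq_of_ne (Ne.symm hj)]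
        simp [hj]
  rw [multiDeriv, h _ (List.nodup_finRange n), if_pos (List.mem_finRange i)]

theorem IsToroidalSymbol.exists_multiDeriv_le {ν : ℝ} (hσ : IsToroidalSymbol ν σ)
    (β : Fin n → ℕ) : ∃ C : ℝ, 0 ≤ C ∧ ∀ x k,
      ‖multiDeriv β (torusLift fun y => σ y k) x‖ ≤ C * (1 + latticeNorm k) ^ ν := by
  obtain ⟨C, hC⟩ := hσ.bound 0 β
  refine ⟨|C|, abs_nonneg C, fun x k => ?_⟩
  have h := hC x k
  rw [multiDiff_zero] at h
  simp only [Pi.zero_apply, Nat.cast_zero, Finset.sum_const_zero, sub_zero] at h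
  refine h.trans (mul_le_mul_of_nonneg_right (le_abs_self C) ?_)
  exact Real.rpow_nonneg (one_add_latticeNorm_pos k).le ν

theorem IsToroidalSymbol.exists_norm_le {ν : ℝ} (hσ : IsToroidalSymbol ν σ) :
    ∃ C : ℝ, 0 ≤ C ∧ ∀ x k, ‖σ x k‖ ≤ C * (1 + latticeNorm k) ^ ν := by
  obtain ⟨C, hC0, hC⟩ := hσ.exists_multiDeriv_le 0
  refine ⟨C, hC0, fun x k => ?_⟩
  obtain ⟨y, rfl⟩ := isOpenQuotientMap_torus.surjective x
  have h := hC y k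
  rwa [multiDeriv_zero] at h

theorem IsToroidalSymbol.exists_norm_symbolCoeff_le {ν : ℝ} (hσ : IsToroidalSymbol ν σ) (N : ℕ) :
    ∃ C : ℝ, ∀ l k,
      ‖symbolCoeff σ l k‖ ≤ C * ((1 + ‖l‖) ^ (-(N : ℝ)) * (1 + latticeNorm k) ^ ν) := by
  obtain ⟨C, hC0, hC⟩ := hσ.exists_norm_le
  choose D hD0 hD using fun i : Fin n => hσ.exists_multiDeriv_le (Pi.single i N)
  have hsum : ∀ i, D i ≤ ∑ i, D i := fun i =>
    Finset.single_le_sum (fun i _ => hD0 i) (Finset.mem_univ i)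
  have hsum0 : 0 ≤ ∑ i, D i := Finset.sum_nonneg fun i _ => hD0 i
  refine ⟨2 ^ N * (C + ∑ i, D i), fun l k => ?_⟩
  have hk : 0 ≤ (1 + latticeNorm k) ^ ν := Real.rpow_nonneg (one_add_latticeNorm_pos k).le ν
  have h := norm_mFourierCoeff_le_of_partialDeriv (hσ.smooth k) (N := N)
    (M := (C + ∑ i, D i) * (1 + latticeNorm k) ^ ν)
    (fun x => (hC x k).trans (mul_le_mul_of_nonneg_right (by linarith) hk))
    (fun i x => by
      have h1 := hD i x k
      rw [multiDeriv_single] at h1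
      exact h1.trans (mul_le_mul_of_nonneg_right (by linarith [hsum i]) hk)) l
  refine h.trans (le_of_eq ?_)
  ring

theorem IsToroidalSymbol.summable_symbolCoeff {ν : ℝ} (hσ : IsToroidalSymbol ν σ)
    (hν : ν < -(n : ℝ)) :
    Summable fun p : IntLattice n × IntLattice n => ‖symbolCoeff σ (p.1 - p.2) p.2‖ := by
  obtain ⟨C, hC⟩ := hσ.exists_norm_symbolCoeff_le (n + 1)
  have h1 : Summable fun l : IntLattice n => (1 + ‖l‖) ^ (-((n + 1 : ℕ) : ℝ)) :=
    summable_one_add_norm_rpow (by push_cast; linarith)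
  have h2 := (h1.mul_of_nonneg (summable_one_add_latticeNorm_rpow hν)
    (fun l => by positivity) fun k => Real.rpow_nonneg (one_add_latticeNorm_pos k).le ν)
  have h3 := h2.comp_injective (i := fun p : IntLattice n × IntLattice n => (p.1 - p.2, p.2))
    fun p q h => by
      rw [Prod.mk.injEq] at h
      exact Prod.ext (by rw [← sub_add_cancel p.1 p.2, h.1, h.2, sub_add_cancel]) h.2
  exact (h3.mul_left C).of_nonneg_of_le (fun _ => norm_nonneg _) fun p => hC _ _

theorem IsToroidalSymbol.exists_poincareAlgebra {ν : ℝ} (hσ : IsToroidalSymbol ν σ)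
    (hν : ν < -(n : ℝ)) : ∃ A ∈ poincareAlgebra n,
      (∀ j k, matrixEntry A j k = symbolCoeff σ (j - k) k) ∧
        ExtendsQuantisation σ (fourierConj A) := by
  obtain ⟨A, hA, hAσ⟩ := exists_mem_poincareAlgebra
    (a := fun p : IntLattice n × IntLattice n => symbolCoeff σ (p.1 - p.2) p.2)
    (hσ.summable_symbolCoeff hν)
  obtain ⟨C, hC0, hC⟩ := hσ.exists_norm_le
  refine ⟨A, hA, hAσ, extendsQuantisation_fourierConj (fun k => (hσ.smooth k).continuous) hAσ hC
    fun f => ?_⟩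
  refine (((summable_one_add_latticeNorm_rpow hν).mul_left C).mul_right ‖f‖).of_nonneg_of_le
    (fun k => ?_) fun k => ?_
  · have := Real.rpow_nonneg (one_add_latticeNorm_pos k).le ν
    positivity
  · have := Real.rpow_nonneg (one_add_latticeNorm_pos k).le ν
    gcongr
    exact norm_mFourierCoeff_le f.norm_coe_le_norm k

theorem chainProd_eq_chainWeight {A : LatticeL2 n →L[ℂ] LatticeL2 n}
    (hA : ∀ j k, matrixEntry A j k = symbolCoeff σ (j - k) k) {m : ℕ} (j : ClosedChain n m) :
    chainProd σ j = chainWeight (matrixEntry A) j.1 := by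
  simp only [chainProd, chainWeight, hA]

theorem plemeljTerm_succ_eq {A : LatticeL2 n →L[ℂ] LatticeL2 n} (hAD : A ∈ poincareAlgebra n)
    (hA : ∀ j k, matrixEntry A j k = symbolCoeff σ (j - k) k) (z : ℂ) (m : ℕ) :
    plemeljTerm σ z (m + 1) = logCoeff m * matrixTrace ((z • A) ^ (m + 1)) := by
  rw [smul_pow, matrixTrace_smul, matrixTrace_pow_succ hAD, plemeljTerm, logCoeff, mul_assoc]
  simp only [chainProd_eq_chainWeight hA]

end Quantisation

section Borderline

variable {n : ℕ}

theorem norm_borderlineSymbol (x : Torus n) (k : IntLattice n) :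
    ‖borderlineSymbol n x k‖ = (1 + latticeNorm k) ^ (-(n : ℝ)) := by
  rw [borderlineSymbol, Complex.norm_real, Real.norm_of_nonneg]
  exact Real.rpow_nonneg (one_add_latticeNorm_pos k).le _

/-- The diagonal operator with entries `(1 + |k|) ^ (-n)`. -/
theorem exists_diagonal_borderline (n : ℕ) : ∃ A : LatticeL2 n →L[ℂ] LatticeL2 n,
    ∀ j k, matrixEntry A j k = if j = k then borderlineSymbol n 0 k else 0 := by
  refine ⟨lp.mapCLM (𝕜 := ℂ) 2 (fun k => borderlineSymbol n 0 k • ContinuousLinearMap.id ℂ ℂ)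
    zero_le_one fun k => ?_, fun j k => ?_⟩
  · refine (norm_smul_le _ _).trans (mul_le_one₀ ?_ (norm_nonneg _) ContinuousLinearMap.norm_id_le)
    rw [norm_borderlineSymbol]
    exact Real.rpow_le_one_of_one_le_of_nonpos (by linarith [latticeNorm_nonneg k])
      (neg_nonpos.2 (Nat.cast_nonneg n))
  · change borderlineSymbol n 0 j * (lp.single 2 k (1 : ℂ) : LatticeL2 n) j = _
    rw [lp.single_apply, Pi.single_apply]
    split_ifs with h <;> simp [h]

theorem symbolCoeff_borderline (l k : IntLattice n) :
    symbolCoeff (borderlineSymbol n) l k = if l = 0 then borderlineSymbol n 0 k else 0 := by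
  have h1 : mFourierCoeff (mFourier (0 : IntLattice n)) l = if l = 0 then 1 else 0 := by
    rw [← repr_toLp_apply]
    have h2 : ContinuousMap.toLp 2 (volume : Measure (Torus n)) ℂ (mFourier 0)
        = mFourierBasis (d := Fin n) 0 := (congrFun coe_mFourierBasis 0).symm
    rw [h2, HilbertBasis.repr_self, lp.single_apply, Pi.single_apply]
  have h3 : symbolCoeff (borderlineSymbol n) l k
      = borderlineSymbol n 0 k * mFourierCoeff (mFourier (0 : IntLattice n)) l := by
    rw [symbolCoeff, ← mFourierCoeff_const_mul]
    simp only [mFourier_zero, ContinuousMap.one_apply, mul_one]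
    rfl
  rw [h3, h1, mul_ite, mul_one, mul_zero]

theorem summable_borderline_mul_norm_mFourierCoeff (hn : 1 ≤ n) (f : C(Torus n, ℂ)) :
    Summable fun k : IntLattice n => (1 + latticeNorm k) ^ (-(n : ℝ)) * ‖mFourierCoeff f k‖ := by
  have h1 : Summable fun k : IntLattice n => ((1 + latticeNorm k) ^ (-(n : ℝ))) ^ 2 := by
    refine (summable_one_add_latticeNorm_rpow (n := n) (r := -(n : ℝ) * (2 : ℕ)) ?_).congr
      fun k => Real.rpow_mul_natCast (one_add_latticeNorm_pos k).le _ _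
    have : (1 : ℝ) ≤ n := by exact_mod_cast hn
    push_cast
    linarith
  have h2 : Summable fun k : IntLattice n => ‖mFourierCoeff f k‖ ^ 2 := by
    refine (hasSum_sq_mFourierCoeff (ContinuousMap.toLp 2 volume ℂ f)).summable.congr fun k => ?_
    rw [mFourierCoeff_toLp]
  refine (h1.add h2).of_nonneg_of_le (fun k => ?_) fun k => ?_
  · exact mul_nonneg (Real.rpow_nonneg (one_add_latticeNorm_pos k).le _) (norm_nonneg _)
  · generalize (1 + latticeNorm k) ^ (-(n : ℝ)) = a
    generalize ‖mFourierCoeff f k‖ = b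
    nlinarith [sq_nonneg (a - b), sq_nonneg (a + b)]

theorem exists_extendsQuantisation_borderline (hn : 1 ≤ n) :
    ∃ A : LatticeL2 n →L[ℂ] LatticeL2 n,
      (∀ j k, matrixEntry A j k = if j = k then borderlineSymbol n 0 k else 0) ∧
        ExtendsQuantisation (borderlineSymbol n) (fourierConj A) := by
  obtain ⟨A, hA⟩ := exists_diagonal_borderline n
  have hA' : ∀ j k, matrixEntry A j k = symbolCoeff (borderlineSymbol n) (j - k) k := fun j k => by
    rw [hA, symbolCoeff_borderline]
    simp only [sub_eq_zero]
  have hc : ∀ k, Continuous fun x => borderlineSymbol n x k := fun k => by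
    unfold borderlineSymbol
    exact continuous_const
  refine ⟨A, hA, ?_⟩
  refine extendsQuantisation_fourierConj hc hA'
    (u := fun k => (1 + latticeNorm k) ^ (-(n : ℝ))) ?_ ?_
  · exact fun x k => (norm_borderlineSymbol x k).le
  · exact summable_borderline_mul_norm_mFourierCoeff hn

theorem not_mem_poincareAlgebra_of_borderline (hn : 1 ≤ n) {A : LatticeL2 n →L[ℂ] LatticeL2 n}
    (hA : ∀ j k, matrixEntry A j k = if j = k then borderlineSymbol n 0 k else 0) :
    A ∉ poincareAlgebra n := by
  intro h
  refine not_summable_one_add_latticeNorm_rpow hn ((summable_matrixEntry_diag h).norm.congr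
    fun k => ?_)
  rw [hA, if_pos rfl, norm_borderlineSymbol]

end Borderline

theorem mainTheorem1 (n : ℕ) (hn : 1 ≤ n) :
    (∀ ν : ℝ, ν < -(n : ℝ) → ∀ σ : Torus n → IntLattice n → ℂ, IsToroidalSymbol ν σ →
      (∃! T : TorusL2 n →L[ℂ] TorusL2 n, ExtendsQuantisation σ T) ∧
      (∀ m : ℕ, 1 ≤ m → Summable fun j : ClosedChain n m => chainProd σ j) ∧
      ∀ T : TorusL2 n →L[ℂ] TorusL2 n, ExtendsQuantisation σ T →
        T ∈ torusPoincareAlgebra n ∧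
        ∃ ε > 0, ∀ z : ℂ, ‖z‖ < ε →
          Summable (fun m : ℕ => plemeljTerm σ z (m + 1)) ∧
          HasTorusDet (z • T) (Complex.exp (∑' m : ℕ, plemeljTerm σ z (m + 1)))) ∧
    (∀ ν : ℝ, -(n : ℝ) ≤ ν → IsToroidalSymbol ν (borderlineSymbol n)) ∧
    (∃! T : TorusL2 n →L[ℂ] TorusL2 n, ExtendsQuantisation (borderlineSymbol n) T) ∧
    ∀ T : TorusL2 n →L[ℂ] TorusL2 n, ExtendsQuantisation (borderlineSymbol n) T →
      T ∉ torusPoincareAlgebra n := by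
  refine ⟨fun ν hν σ hσ => ?_, fun ν hν => isToroidalSymbol_borderline hν, ?_⟩
  · obtain ⟨A, hAD, hA, hext⟩ := hσ.exists_poincareAlgebra hν
    refine ⟨⟨_, hext, fun T hT => hT.unique hext⟩, fun m hm => ?_, fun T hT => ?_⟩
    · obtain ⟨m, rfl⟩ := Nat.exists_eq_succ_of_ne_zero (Nat.one_le_iff_ne_zero.1 hm)
      simp only [chainProd_eq_chainWeight hA]
      exact summable_closedChain hAD m
    · obtain rfl := hT.unique hext
      refine ⟨⟨A, hAD, rfl⟩, (poincareNorm A + 1)⁻¹, ?_, fun z hz => ?_⟩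
      · have : 0 ≤ poincareNorm A := tsum_nonneg fun _ => norm_nonneg _
        positivity
      · have h0 : 0 ≤ poincareNorm A := tsum_nonneg fun _ => norm_nonneg _
        have hnorm : poincareNorm (z • A) = ‖z‖ * poincareNorm A := by
          simp only [poincareNorm_eq_toReal, poincareENorm_smul, ENNReal.toReal_mul,
            toReal_enorm]
        have hmem : z • A ∈ poincareAlgebra n := by
          rw [mem_poincareAlgebra_iff, poincareENorm_smul]
          exact ENNReal.mul_ne_top enorm_ne_top (mem_poincareAlgebra_iff.1 hAD)
        have hlt : poincareNorm (z • A) < 1 := by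
          rw [hnorm]
          calc ‖z‖ * poincareNorm A ≤ (poincareNorm A + 1)⁻¹ * poincareNorm A := by gcongr
            _ < 1 := by
              rw [inv_mul_lt_one₀ (by positivity)]
              linarith
        obtain ⟨h1, h2⟩ := hasPoincareDet_of_poincareNorm_lt_one hmem hlt
        simp only [plemeljTerm_succ_eq hAD hA]
        exact ⟨h1, z • A, fourierConj_smul z A, h2⟩
  · obtain ⟨A, hA, hext⟩ := exists_extendsQuantisation_borderline hn
    refine ⟨⟨_, hext, fun T hT => hT.unique hext⟩, ?_⟩
    rintro T hT ⟨B, hB, rfl⟩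
    obtain rfl := fourierConj_injective (hT.unique hext)
    exact not_mem_poincareAlgebra_of_borderline hn hA hB
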